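/- Let $\{0,1\}^*$ be the set of finite binary strings and $\Lambda$ the empty string. A function $f:\{0,1\}^*\to[0,\infty)$ is \emph{lower semicomputable} if $f(x)=\lim_n M(x,n)$ for a total computable function $M$ with non-negative rational values that is non-decreasing in $n$. A \emph{discrete semimeasure} is a function $m:\{0,1\}^*\to[0,\infty)$ with $\sum_x m(x)\le 1$; a \emph{continuous semimeasure} is a function $a:\{0,1\}^*\to[0,\infty)$ with $a(\Lambda)=1$ and $a(x)\ge a(x0)+a(x1)$ for all $x$. Let $\mathbf m$ be a discrete a priori probability, that is, a lower semicomputable discrete semimeasure that is maximal up to a constant factor among all such semimeasures, and let $\mathbf A$ be a continuous a priori probability, that is, a lower semicomputable continuous semimeasure that is maximal up to a constant factor among all such semimeasures. Then there exists an infinite binary sequence $\omega$ such that $$\sum_{x\sqsubset\omega}\frac{\mathbf m(x)}{\mathbf A(x)}=\infty ,$$ where $x\sqsubset\omega$ means that $x$ ranges over all finite prefixes of $\omega$. In terms of complexities, for the same $\omega$ one has $$\sum_{x\sqsubset\omega}2^{KA(x)-KP(x)}=\infty ,$$ where $KA(x)=-\log_2\mathbf A(x)$ and $KP$ is prefix complexity: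 $KP(x)=KP_D(x)$ is the minimal length of $p$ with $D(p)=x$, for any partial computable function $D:\{0,1\}^*\to\{0,1\}^*$ with prefix-free domain that is optimal, i.e., for every partial computable $D'$ with prefix-free domain there is a constant $c$ with $KP_D(x)\le KP_{D'}(x)+c$ for all $x$. -/

import Mathlib

open scoped ENNReal

namespace Apriori

/-- A function on binary strings is lower semicomputable if it is the pointwise limit of a
non-decreasing sequence `M x 0 ≤ M x 1 ≤ …` of non-negative rational numbers, where `M` is a total
computable function. The rational `M x n` is given by a numerator `p x n` and a (positive)
denominator `q x n + 1`, both computable. -/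
def LowerSemicomputable (f : List Bool → ℝ) : Prop :=
  ∃ p q : List Bool → ℕ → ℕ, Computable₂ p ∧ Computable₂ q ∧
    ∀ x, Monotone (fun n => (p x n : ℝ) / ((q x n : ℝ) + 1)) ∧
      Filter.Tendsto (fun n => (p x n : ℝ) / ((q x n : ℝ) + 1)) Filter.atTop (nhds (f x))

/-- Discrete semimeasures on the set of binary strings. -/
structure IsDiscreteSemimeasure (m : List Bool → ℝ) : Prop where
  nonneg : ∀ x, 0 ≤ m x
  summable : Summable m
  tsum_le_one : ∑' x, m x ≤ 1

/-- Continuous semimeasures (semimeasures on the binary tree). The first bit of a string is the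
head of the list, so the two sons of `x` are `x ++ [false]` and `x ++ [true]`. -/
structure IsContinuousSemimeasure (a : List Bool → ℝ) : Prop where
  nonneg : ∀ x, 0 ≤ a x
  root : a [] = 1
  add_le : ∀ x, a (x ++ [false]) + a (x ++ [true]) ≤ a x

/-- `m` is a discrete a priori probability: a lower semicomputable discrete semimeasure that is
maximal up to a constant factor. -/
structure IsDiscreteApriori (m : List Bool → ℝ) : Prop where
  semimeasure : IsDiscreteSemimeasure m
  lsc : LowerSemicomputable m
  maximal : ∀ m' : List Bool → ℝ, IsDiscreteSemimeasure m' → LowerSemicomputable m' →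
    ∃ c : ℝ, ∀ x, m' x ≤ c * m x

/-- `A` is a continuous a priori probability: a lower semicomputable continuous semimeasure that is
maximal up to a constant factor. -/
structure IsContinuousApriori (A : List Bool → ℝ) : Prop where
  semimeasure : IsContinuousSemimeasure A
  lsc : LowerSemicomputable A
  maximal : ∀ a : List Bool → ℝ, IsContinuousSemimeasure a → LowerSemicomputable a →
    ∃ c : ℝ, ∀ x, a x ≤ c * A x

/-- The a priori complexity `KA x = - log₂ (A x)`. -/
noncomputable def KA (A : List Bool → ℝ) (x : List Bool) : ℝ := -Real.logb 2 (A x)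

/-- Computable partial functions on binary strings whose domain is prefix-free. -/
structure IsPrefixFreeMachine (D : List Bool →. List Bool) : Prop where
  partrec : Partrec D
  prefixFree : ∀ p q, (D p).Dom → (D q).Dom → p <+: q → p = q

/-- `KP D x` is the minimal length of `p` with `D p = x` (infinite if there is none). -/
noncomputable def KP (D : List Bool →. List Bool) (x : List Bool) : ℕ∞ :=
  ⨅ (p : List Bool) (_ : x ∈ D p), (p.length : ℕ∞)

/-- Prefix-free machines `D` for which `KP D` is minimal up to an additive constant. For such `D`
the function `KP D` is a version of prefix complexity, and all its values are finite. -/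
structure IsOptimalPrefixFreeMachine (D : List Bool →. List Bool) : Prop where
  machine : IsPrefixFreeMachine D
  optimal : ∀ D' : List Bool →. List Bool, IsPrefixFreeMachine D' →
    ∃ c : ℕ, ∀ x, KP D x ≤ KP D' x + c

/-- The prefix of length `n` of an infinite binary sequence. -/
def pre (ω : ℕ → Bool) (n : ℕ) : List Bool := (List.range n).map ω

end Apriori

/-! The prefix sums of `m / A` are lower semicontinuous in `ω`. By Baire category it is therefore
enough that they are unbounded on every cylinder: if all were finite, some closed set where the sum
is at most `N` would contain a cylinder (`exists_prefixSum_eq_top`). Unboundedness comes from a game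
against the enumeration of `A`. For all `x₀` and `T`, a computable strategy issues requests of total
weight at most `2` whose weights divided by `A` add up to at least `T` along a branch through `x₀`
(`exists_le_prefixSum`). The strategies for `T = 4 ^ e`, scaled by `2 ^ -(e + 2)`, have joint weight
at most `1`, while their gains `2 ^ (e - 2)` are unbounded. Up to constant factors their requests
bound `m` from below, and also `2 ^ -KP` through a Kraft–Chaitin code; hence one `ω` serves both
sums.

In the game, a node of weight `d` with remaining goal `K` and efficiency `ρ` is abandoned once `A ≥
(ρ / K) w` on it, where `w` is the weight spent in its subtree, its own included. Until then it
contributes `d / A > K d / (ρ w)`. A child is therefore created with the smaller goal `K (1 - d / (2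
ρ w))`, the `2` allowing for the growth of `w` while that child is served. A smaller goal means that
abandoning the child costs more `A`: per unit of `w`, the children take at least `(σ / K) (1 + d /
(2 ρ w))`, with `σ` their efficiency. Integration gives `forced`. Once `w / d` reaches `cap`, its
logarithm outweighs both the missing `d` and the loss `ρ - σ = 1 / B`, so the node itself can be
abandoned (`le_forced`).

Thus the efficiency may drop from `T` at depth `0`, where goal and efficiency cancel and the
threshold is `A ≥ w`, to `1` at depth `B (T - 1)`. Abandoned nodes of depth `0` are incomparable and
carry `A` at least equal to the weight spent on them; so they use at most `1`, and the current one
uses at most `1` more (`run_fst_le`). The state must then become constant, with a full stack and no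
node to abandon. The differences of goals telescope along it (`FrameOk.sub_goal_le`), and the leaf,
where `w = d` and the efficiency is `1`, supplies the remaining goal. -/

namespace Apriori

/-! ### Sums of computable sequences of dyadic weights -/

/-- The weight `2⁻ˡ` of a request of length `l`; a missing request has weight zero. -/
noncomputable def weight : Option ℕ → ℝ
  | none => 0
  | some l => (1 / 2) ^ l

lemma weight_nonneg (o : Option ℕ) : 0 ≤ weight o := by
  cases o <;> simp [weight]

/-- One step of the summation of dyadic weights, on numerator and denominator. -/
def addWeight (s : ℕ × ℕ) : Option ℕ → ℕ × ℕ
  | none => s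
  | some l => (s.1 * 2 ^ l + s.2, s.2 * 2 ^ l)

/-- The numerator and the denominator of `∑ r < n, weight (u r)`. -/
def partialSum (u : ℕ → Option ℕ) : ℕ → ℕ × ℕ
  | 0 => (0, 1)
  | n + 1 => addWeight (partialSum u n) (u n)

lemma partialSum_den_pos (u : ℕ → Option ℕ) (n : ℕ) : 0 < (partialSum u n).2 := by
  induction n with
  | zero => simp [partialSum]
  | succ n ih =>
    rw [partialSum]
    cases u n with
    | none => simpa [addWeight] using ih
    | some l => simp [addWeight, ih]

lemma partialSum_div (u : ℕ → Option ℕ) (n : ℕ) :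
    ((partialSum u n).1 : ℝ) / (partialSum u n).2 = ∑ r ∈ Finset.range n, weight (u r) := by
  induction n with
  | zero => simp [partialSum]
  | succ n ih =>
    have h := partialSum_den_pos u n
    rw [Finset.sum_range_succ, ← ih, partialSum]
    cases u n with
    | none => simp [addWeight, weight]
    | some l =>
      simp only [addWeight, weight]
      push_cast
      rw [one_div, inv_pow]
      field_simp

lemma primrec_pow : Primrec₂ ((· ^ ·) : ℕ → ℕ → ℕ) :=
  Primrec₂.unpaired'.1 Nat.Primrec.pow

lemma primrec_addWeight : Primrec₂ addWeight := by
  have h : Primrec (fun a : (ℕ × ℕ) × Option ℕ => (Option.casesOn a.2 a.1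
      (fun l => (a.1.1 * 2 ^ l + a.1.2, a.1.2 * 2 ^ l)) : ℕ × ℕ)) := by
    refine Primrec.option_casesOn Primrec.snd Primrec.fst ?_
    have hp : Primrec (fun b : ((ℕ × ℕ) × Option ℕ) × ℕ => 2 ^ b.2) :=
      primrec_pow.comp (Primrec.const 2) Primrec.snd
    have h1 : Primrec (fun b : ((ℕ × ℕ) × Option ℕ) × ℕ => b.1.1) :=
      Primrec.fst.comp Primrec.fst
    exact Primrec.pair
      (Primrec.nat_add.comp (Primrec.nat_mul.comp (Primrec.fst.comp h1) hp) (Primrec.snd.comp h1))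
      (Primrec.nat_mul.comp (Primrec.snd.comp h1) hp)
  refine h.of_eq fun a => ?_
  rcases a with ⟨s, _ | l⟩ <;> rfl

lemma computable_partialSum {α : Type*} [Primcodable α] {u : α → ℕ → Option ℕ}
    (hu : Computable₂ u) : Computable₂ (fun a n => partialSum (u a) n) := by
  have h : Computable (fun b : α × ℕ => (Nat.rec (0, 1)
      (fun n s => addWeight s (u b.1 n)) b.2 : ℕ × ℕ)) := by
    refine Computable.nat_rec (h := fun b s => addWeight s.2 (u b.1 s.1)) Computable.snd
      (Computable.const _) ?_
    exact primrec_addWeight.to_comp.comp (α := (α × ℕ) × ℕ × (ℕ × ℕ))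
      (Computable.snd.comp Computable.snd)
      (hu.comp (Computable.fst.comp Computable.fst) (Computable.fst.comp Computable.snd))
  refine h.of_eq fun b => ?_
  rcases b with ⟨a, n⟩
  induction n with
  | zero => rfl
  | succ n ih => exact congrArg (fun s => addWeight s (u a n)) ih

/-- A sequence of requests: the `r`-th request, if there is one, asks for a description of length
`l` of the string `x`. -/
abbrev Requests := ℕ → Option (List Bool × ℕ)

/-- The length in a request. -/
def lengthOf (o : Option (List Bool × ℕ)) : Option ℕ := o.map Prod.snd

/-- The length in a request for the string `x`. -/
def lengthFor (x : List Bool) (o : Option (List Bool × ℕ)) : Option ℕ :=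
  o.bind fun y => if y.1 = x then some y.2 else none

lemma computable_lengthOf {ev : Requests} (h : Computable ev) :
    Computable fun r => lengthOf (ev r) :=
  Computable.option_map h (Computable.snd.comp Computable.snd)

lemma primrec_lengthFor : Primrec₂ lengthFor := by
  have : Primrec (fun a : List Bool × Option (List Bool × ℕ) => a.2.bind fun y =>
      if y.1 = a.1 then some y.2 else none) := by
    refine Primrec.option_bind Primrec.snd ?_
    refine Primrec.ite ?_ (Primrec.option_some.comp (Primrec.snd.comp Primrec.snd))
      (Primrec.const none)
    exact Primrec.eq.comp (Primrec.fst.comp Primrec.snd) (Primrec.fst.comp Primrec.fst)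
  exact this

/-! ### The discrete semimeasure of a sequence of requests -/

lemma sum_weight_lengthFor_le (o : Option (List Bool × ℕ)) (s : Finset (List Bool)) :
    ∑ x ∈ s, weight (lengthFor x o) ≤ weight (lengthOf o) := by
  rcases o with _ | ⟨y, l⟩
  · simp [lengthFor, lengthOf, weight]
  · have h : ∀ x, weight (lengthFor x (some (y, l))) = if y = x then (1 / 2 : ℝ) ^ l else 0 := by
      intro x
      by_cases hx : y = x <;> simp [lengthFor, weight, hx]
    rw [Finset.sum_congr rfl fun x _ => h x, Finset.sum_ite_eq]
    simp only [lengthOf, weight, Option.map_some]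
    split_ifs <;> simp

lemma weight_lengthFor_le (o : Option (List Bool × ℕ)) (x : List Bool) :
    weight (lengthFor x o) ≤ weight (lengthOf o) := by
  simpa using sum_weight_lengthFor_le o {x}

/-- The semimeasure defined by a sequence of requests. -/
noncomputable def requestMeasure (ev : Requests) (x : List Bool) : ℝ :=
  ∑' r, weight (lengthFor x (ev r))

/-- The total weight of the requests is at most one. -/
def Requests.KraftLe (ev : Requests) : Prop :=
  ∀ n, ∑ r ∈ Finset.range n, weight (lengthOf (ev r)) ≤ 1

lemma summable_weight {ev : Requests} (hev : ev.KraftLe) :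
    Summable fun r => weight (lengthOf (ev r)) :=
  summable_of_sum_range_le (fun _ => weight_nonneg _) hev

lemma summable_weight_lengthFor {ev : Requests} (hev : ev.KraftLe) (x : List Bool) :
    Summable fun r => weight (lengthFor x (ev r)) :=
  (summable_weight hev).of_nonneg_of_le (fun _ => weight_nonneg _)
    (fun _ => weight_lengthFor_le _ _)

lemma weight_le_requestMeasure {ev : Requests} (hev : ev.KraftLe) {r l : ℕ} {x : List Bool}
    (h : ev r = some (x, l)) :
    (1 / 2 : ℝ) ^ l ≤ requestMeasure ev x := by
  have := (summable_weight_lengthFor hev x).le_tsum r (fun _ _ => weight_nonneg _)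
  rw [h] at this
  have e : weight (lengthFor x (some (x, l))) = (1 / 2) ^ l := by simp [lengthFor, weight]
  rwa [e] at this

lemma isDiscreteSemimeasure_requestMeasure {ev : Requests} (hev : ev.KraftLe) :
    IsDiscreteSemimeasure (requestMeasure ev) := by
  have h0 : ∀ x, 0 ≤ requestMeasure ev x := fun x => tsum_nonneg fun _ => weight_nonneg _
  have hs : ∀ s : Finset (List Bool), ∑ x ∈ s, requestMeasure ev x ≤ 1 := by
    intro s
    unfold requestMeasure
    rw [← Summable.tsum_finsetSum fun x _ => summable_weight_lengthFor hev x]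
    calc _ ≤ ∑' r, weight (lengthOf (ev r)) :=
          Summable.tsum_le_tsum (fun r => sum_weight_lengthFor_le _ _)
            (summable_sum fun x _ => summable_weight_lengthFor hev x) (summable_weight hev)
      _ ≤ 1 := (summable_weight hev).tsum_le_of_sum_range_le hev
  exact ⟨h0, summable_of_sum_le h0 hs, Real.tsum_le_of_sum_le h0 hs⟩

lemma lowerSemicomputable_requestMeasure {ev : Requests} (hev : ev.KraftLe) (hc : Computable ev) :
    LowerSemicomputable (requestMeasure ev) := by
  have hu : Computable₂ (fun (x : List Bool) r => lengthFor x (ev r)) :=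
    primrec_lengthFor.to_comp.comp Computable.fst (hc.comp Computable.snd)
  have hP := computable_partialSum hu
  -- `LowerSemicomputable` asks for denominators of the form `q + 1`, whence the subtraction of `1`.
  have key : ∀ (x : List Bool) n, ((partialSum (fun r => lengthFor x (ev r)) n).1 : ℝ) /
      (((partialSum (fun r => lengthFor x (ev r)) n).2 - 1 : ℕ) + 1) =
      ∑ r ∈ Finset.range n, weight (lengthFor x (ev r)) := by
    intro x n
    rw [← partialSum_div]
    have := partialSum_den_pos (fun r => lengthFor x (ev r)) n
    rw [Nat.cast_sub (by omega)]
    simp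
  refine ⟨fun x n => (partialSum (fun r => lengthFor x (ev r)) n).1,
    fun x n => (partialSum (fun r => lengthFor x (ev r)) n).2 - 1,
    Computable.fst.comp hP, ?_, fun x => ⟨?_, ?_⟩⟩
  · exact Primrec.nat_sub.to_comp.comp (Computable.snd.comp hP) (Computable.const 1)
  · simp only [key]
    refine monotone_nat_of_le_succ fun n => ?_
    rw [Finset.sum_range_succ]
    exact le_add_of_nonneg_right (weight_nonneg _)
  · simp only [key]
    exact (summable_weight_lengthFor hev x).hasSum.tendsto_sum_nat

/-! ### The prefix-free machine of a sequence of requests -/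

/-- The number with a given binary expansion. -/
def binVal (p : List Bool) : ℕ := p.foldl (fun v b => 2 * v + b.toNat) 0

lemma binVal_concat (p : List Bool) (b : Bool) : binVal (p ++ [b]) = 2 * binVal p + b.toNat := by
  simp [binVal]

/-- Extending a word means passing to a subinterval of its dyadic interval. -/
lemma binVal_append_bounds (p t : List Bool) :
    binVal p * 2 ^ t.length ≤ binVal (p ++ t) ∧
      binVal (p ++ t) < (binVal p + 1) * 2 ^ t.length := by
  induction t using List.reverseRecOn with
  | nil => simp
  | append_singleton t b ih =>
    rw [← List.append_assoc, binVal_concat, List.length_append, List.length_singleton, pow_succ]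
    have : b.toNat ≤ 1 := Bool.toNat_le b
    constructor
    · linarith [ih.1]
    · have := ih.2
      nlinarith

lemma exists_binVal_eq (l v : ℕ) (h : v < 2 ^ l) : ∃ p : List Bool, p.length = l ∧ binVal p = v := by
  induction l generalizing v with
  | zero => exact ⟨[], rfl, by simp at h; simp [binVal, h]⟩
  | succ l ih =>
    obtain ⟨p, hp, hv⟩ := ih (v / 2) (by rw [pow_succ] at h; omega)
    refine ⟨p ++ [decide (v % 2 = 1)], by simp [hp], ?_⟩
    rw [binVal_concat, hv]
    by_cases h2 : v % 2 = 1
    · simp [h2]; omega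
    · simp [h2]; omega

/-- The binary value of the code word (of length `l + 1`) for the `r`-th request: the left end of
a dyadic interval inside the part of `[0, 1]` reserved for this request. -/
def codeVal (u : ℕ → Option ℕ) (r l : ℕ) : ℕ :=
  (partialSum u r).1 * 2 ^ (l + 1) / (partialSum u r).2 + 1

/-- The interval of length `2⁻ˡ` reserved for request `r` need not be aligned, but it contains an
aligned dyadic interval of half that length. The extra bit replaces any sorting of the requests by
length. -/
lemma codeVal_bounds (u : ℕ → Option ℕ) (r l : ℕ) (h : u r = some l) :
    ∑ i ∈ Finset.range r, weight (u i) ≤ codeVal u r l / 2 ^ (l + 1) ∧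
      ((codeVal u r l : ℝ) + 1) / 2 ^ (l + 1) ≤ ∑ i ∈ Finset.range (r + 1), weight (u i) := by
  rw [Finset.sum_range_succ, ← partialSum_div, h, weight]
  have hd := partialSum_den_pos u r
  set N := (partialSum u r).1
  set D := (partialSum u r).2
  have h1 : N * 2 ^ (l + 1) / D * D ≤ N * 2 ^ (l + 1) := Nat.div_mul_le_self _ _
  have h2 : N * 2 ^ (l + 1) < (N * 2 ^ (l + 1) / D + 1) * D := by
    have := Nat.lt_mul_div_succ (N * 2 ^ (l + 1)) hd
    linarith [mul_comm D (N * 2 ^ (l + 1) / D + 1)]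
  have e : codeVal u r l = N * 2 ^ (l + 1) / D + 1 := rfl
  rw [e]
  set Q := N * 2 ^ (l + 1) / D
  have h1' : (Q : ℝ) * D ≤ N * 2 ^ (l + 1) := by exact_mod_cast h1
  have h2' : (N : ℝ) * 2 ^ (l + 1) < (Q + 1) * D := by exact_mod_cast h2
  have hd' : (0 : ℝ) < D := by exact_mod_cast hd
  have hp : (0 : ℝ) < 2 ^ l := by positivity
  push_cast
  constructor
  · rw [div_le_div_iff₀ hd' (by positivity)]
    exact h2'.le
  · have e2 : (N : ℝ) / D + (1 / 2) ^ l = (N * 2 ^ (l + 1) / D + 2) / 2 ^ (l + 1) := by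
      rw [one_div, inv_pow, pow_succ]; field_simp
    rw [e2]
    refine div_le_div_of_nonneg_right ?_ (by positivity)
    have : (Q : ℝ) ≤ N * 2 ^ (l + 1) / D := by rwa [le_div_iff₀ hd']
    linarith

/-- The answer to the `r`-th request if `p` is its code word. -/
def answer (ev : Requests) (p : List Bool) (r : ℕ) : Option (List Bool) :=
  (ev r).bind fun y => if p.length = y.2 + 1 ∧ binVal p = codeVal (fun i => lengthOf (ev i)) r y.2
    then some y.1 else none

lemma mem_answer {ev : Requests} {p x : List Bool} {r : ℕ} : x ∈ answer ev p r ↔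
    ∃ l, ev r = some (x, l) ∧ p.length = l + 1 ∧
      binVal p = codeVal (fun i => lengthOf (ev i)) r l := by
  unfold answer
  rcases ev r with _ | ⟨y, l⟩
  · simp
  · simp only [Option.bind_some, Option.mem_def, Option.ite_none_right_eq_some, Option.some.injEq,
      Prod.mk.injEq]
    constructor
    · rintro ⟨h, rfl⟩
      exact ⟨l, ⟨rfl, rfl⟩, h⟩
    · rintro ⟨l', ⟨rfl, rfl⟩, h⟩
      exact ⟨h, rfl⟩

lemma primrec_binVal : Primrec binVal := by
  refine Primrec.list_foldl (h := fun (_ : List Bool) (s : ℕ × Bool) => 2 * s.1 + s.2.toNat)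
    Primrec.id (Primrec.const 0) ?_
  exact Primrec.nat_add.comp (α := List Bool × ℕ × Bool)
    (Primrec.nat_mul.comp (Primrec.const 2) (Primrec.fst.comp Primrec.snd))
    ((Primrec.dom_bool Bool.toNat).comp (Primrec.snd.comp Primrec.snd))

lemma computable_answer {ev : Requests} (hc : Computable ev) : Computable₂ (answer ev) := by
  have hP : Computable (fun r => partialSum (fun i => lengthOf (ev i)) r) :=
    (computable_partialSum (α := Unit) (u := fun _ i => lengthOf (ev i))
      ((computable_lengthOf hc).comp Computable.snd)).comp (Computable.const ()) Computable.id
  have hcore : Primrec (fun b : (List Bool × Option (List Bool × ℕ)) × ℕ × ℕ =>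
      b.1.2.bind fun y => if b.1.1.length = y.2 + 1 ∧
        binVal b.1.1 = b.2.1 * 2 ^ (y.2 + 1) / b.2.2 + 1 then some y.1 else none) := by
    refine Primrec.option_bind (Primrec.snd.comp Primrec.fst) ?_
    have hp : Primrec (fun b : ((List Bool × Option (List Bool × ℕ)) × ℕ × ℕ) × (List Bool × ℕ) =>
        b.1.1.1) := Primrec.fst.comp (Primrec.fst.comp Primrec.fst)
    have hl : Primrec (fun b : ((List Bool × Option (List Bool × ℕ)) × ℕ × ℕ) × (List Bool × ℕ) =>
        b.2.2 + 1) := Primrec.succ.comp (Primrec.snd.comp Primrec.snd)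
    have hN : Primrec (fun b : ((List Bool × Option (List Bool × ℕ)) × ℕ × ℕ) × (List Bool × ℕ) =>
        b.1.2) := Primrec.snd.comp Primrec.fst
    refine Primrec.ite (PrimrecPred.and ?_ ?_)
      (Primrec.option_some.comp (Primrec.fst.comp Primrec.snd)) (Primrec.const none)
    · exact Primrec.eq.comp (Primrec.list_length.comp hp) hl
    · refine Primrec.eq.comp (primrec_binVal.comp hp) (Primrec.succ.comp ?_)
      exact Primrec.nat_div.comp (Primrec.nat_mul.comp (Primrec.fst.comp hN)
        (primrec_pow.comp (Primrec.const 2) hl)) (Primrec.snd.comp hN)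
  exact hcore.to_comp.comp (Computable.pair
    (Computable.pair Computable.fst (hc.comp Computable.snd)) (hP.comp Computable.snd))

/-- The machine serving a sequence of requests. -/
def requestMachine (ev : Requests) : List Bool →. List Bool := fun p => Nat.rfindOpt (answer ev p)

/-- Comparable code words have nested intervals, whereas the intervals reserved for different
requests do not overlap. No bound on the total weight enters. -/
lemma codeVal_interval_unique {ev : Requests} {p t : List Bool} {r r' l l' : ℕ} {x x' : List Bool}
    (h : ev r = some (x, l)) (h' : ev r' = some (x', l'))
    (hl : p.length = l + 1) (hl' : (p ++ t).length = l' + 1)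
    (hv : binVal p = codeVal (fun i => lengthOf (ev i)) r l)
    (hv' : binVal (p ++ t) = codeVal (fun i => lengthOf (ev i)) r' l') : r = r' := by
  obtain ⟨b1, b2⟩ := binVal_append_bounds p t
  have c := codeVal_bounds (fun i => lengthOf (ev i)) r l (by simp [h, lengthOf])
  have c' := codeVal_bounds (fun i => lengthOf (ev i)) r' l' (by simp [h', lengthOf])
  rw [← hv] at c
  rw [← hv'] at c'
  have mono : Monotone fun n => ∑ i ∈ Finset.range n, weight (lengthOf (ev i)) :=
    monotone_nat_of_le_succ fun n => by
      rw [Finset.sum_range_succ]; exact le_add_of_nonneg_right (weight_nonneg _)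
  have e : (2 : ℝ) ^ (l' + 1) = 2 ^ (l + 1) * 2 ^ t.length := by
    rw [← hl', List.length_append, hl, pow_add]
  have hp : (0 : ℝ) < 2 ^ (l + 1) := by positivity
  have ht : (0 : ℝ) < 2 ^ t.length := by positivity
  have b1' : (binVal p : ℝ) * 2 ^ t.length ≤ binVal (p ++ t) := by exact_mod_cast b1
  have b2' : (binVal (p ++ t) : ℝ) < (binVal p + 1) * 2 ^ t.length := by exact_mod_cast b2
  have d1 : (binVal p : ℝ) / 2 ^ (l + 1) ≤ binVal (p ++ t) / 2 ^ (l' + 1) := by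
    rw [e, div_le_div_iff₀ hp (by positivity)]
    nlinarith
  have d2 : (binVal (p ++ t) : ℝ) / 2 ^ (l' + 1) < (binVal p + 1) / 2 ^ (l + 1) := by
    rw [e, div_lt_div_iff₀ (by positivity) hp]
    nlinarith
  have d3 : (binVal (p ++ t) : ℝ) / 2 ^ (l' + 1) < (binVal (p ++ t) + 1) / 2 ^ (l' + 1) := by
    gcongr; linarith
  rcases lt_trichotomy r r' with hlt | heq | hlt
  · have := mono (show r + 1 ≤ r' from hlt)
    simp only at this
    linarith [c.2, c'.1]
  · exact heq
  · have := mono (show r' + 1 ≤ r from hlt)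
    simp only at this
    linarith [c'.2, c.1]

lemma isPrefixFreeMachine_requestMachine {ev : Requests} (hc : Computable ev) :
    IsPrefixFreeMachine (requestMachine ev) := by
  refine ⟨Partrec.rfindOpt (computable_answer hc), ?_⟩
  rintro p q hp hq ⟨t, rfl⟩
  obtain ⟨r, x, hx⟩ := Nat.rfindOpt_dom.1 hp
  obtain ⟨r', x', hx'⟩ := Nat.rfindOpt_dom.1 hq
  obtain ⟨l, h, hl, hv⟩ := mem_answer.1 hx
  obtain ⟨l', h', hl', hv'⟩ := mem_answer.1 hx'
  obtain rfl := codeVal_interval_unique h h' hl hl' hv hv'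
  rw [h] at h'
  simp only [Option.some.injEq, Prod.mk.injEq] at h'
  rw [List.length_append] at hl'
  have : t = [] := List.length_eq_zero_iff.1 (by omega)
  simp [this]

lemma KP_requestMachine_le {ev : Requests} (hev : ev.KraftLe) {r l : ℕ} {x : List Bool}
    (h : ev r = some (x, l)) : KP (requestMachine ev) x ≤ (l + 1 : ℕ) := by
  have c := (codeVal_bounds (fun i => lengthOf (ev i)) r l (by simp [h, lengthOf])).2.trans (hev _)
  rw [div_le_one (by positivity)] at c
  have hlt : codeVal (fun i => lengthOf (ev i)) r l < 2 ^ (l + 1) := by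
    have : codeVal (fun i => lengthOf (ev i)) r l + 1 ≤ 2 ^ (l + 1) := by exact_mod_cast c
    omega
  obtain ⟨p, hl, hv⟩ := exists_binVal_eq _ _ hlt
  have hdom : (requestMachine ev p).Dom :=
    Nat.rfindOpt_dom.2 ⟨r, x, mem_answer.2 ⟨l, h, hl, hv⟩⟩
  obtain ⟨y, hy⟩ := Part.dom_iff_mem.1 hdom
  obtain ⟨r', hr'⟩ := Nat.rfindOpt_spec hy
  obtain ⟨l', h', hl', hv'⟩ := mem_answer.1 hr'
  -- The search may stop at another index `r'`; uniqueness for the same code word identifies it with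
  -- `r`.
  obtain rfl : r = r' := codeVal_interval_unique (t := []) h h' hl (by simpa using hl') hv
    (by simpa using hv')
  rw [h] at h'
  simp only [Option.some.injEq, Prod.mk.injEq] at h'
  obtain ⟨rfl, rfl⟩ := h'
  unfold KP
  rw [← hl]
  exact iInf₂_le p hy

/-! ### Continuous semimeasures -/

/-- The string `x 1ⁱ 0`. For a fixed `x` these strings are pairwise incomparable extensions
of `x`. -/
def child (x : List Bool) (i : ℕ) : List Bool := x ++ (List.replicate i true ++ [false])

lemma IsContinuousSemimeasure.sum_child_add_le {a : List Bool → ℝ} (h : IsContinuousSemimeasure a)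
    (x : List Bool) (n : ℕ) :
    ∑ i ∈ Finset.range n, a (child x i) + a (x ++ List.replicate n true) ≤ a x := by
  induction n with
  | zero => simp
  | succ n ih =>
    have := h.add_le (x ++ List.replicate n true)
    rw [Finset.sum_range_succ]
    have e1 : x ++ List.replicate n true ++ [false] = child x n := by simp [child]
    have e2 : x ++ List.replicate n true ++ [true] = x ++ List.replicate (n + 1) true := by
      rw [List.append_assoc, List.replicate_succ']
    rw [e1, e2] at this
    linarith

lemma IsContinuousSemimeasure.sum_child_le {a : List Bool → ℝ} (h : IsContinuousSemimeasure a)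
    (x : List Bool) (n : ℕ) : ∑ i ∈ Finset.range n, a (child x i) ≤ a x := by
  linarith [h.sum_child_add_le x n, h.nonneg (x ++ List.replicate n true)]

lemma IsContinuousSemimeasure.le_one {a : List Bool → ℝ} (h : IsContinuousSemimeasure a)
    (x : List Bool) : a x ≤ 1 := by
  induction x using List.reverseRecOn with
  | nil => exact h.root.le
  | append_singleton x b ih =>
    have := h.add_le x
    cases b
    · linarith [h.nonneg (x ++ [true])]
    · linarith [h.nonneg (x ++ [false])]

lemma isContinuousSemimeasure_uniform :
    IsContinuousSemimeasure fun x => (1 / 2 : ℝ) ^ x.length := by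
  refine ⟨fun x => by positivity, by simp, fun x => ?_⟩
  simp only [List.length_append, List.length_singleton, pow_succ]
  linarith

lemma lowerSemicomputable_uniform : LowerSemicomputable fun x => (1 / 2 : ℝ) ^ x.length := by
  have e : ∀ x : List Bool, ((1 : ℕ) : ℝ) / (((2 ^ x.length - 1 : ℕ) : ℝ) + 1) =
      (1 / 2 : ℝ) ^ x.length := by
    intro x
    rw [Nat.cast_sub Nat.one_le_two_pow]
    simp
  refine ⟨fun _ _ => 1, fun x _ => 2 ^ x.length - 1, Computable.const 1, ?_, fun x => ?_⟩
  · exact Primrec.to_comp (Primrec.nat_sub.comp (primrec_pow.comp (Primrec.const 2)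
      (Primrec.list_length.comp Primrec.fst)) (Primrec.const 1))
  · simp only [e]
    exact ⟨monotone_const, tendsto_const_nhds⟩

lemma IsContinuousApriori.pos {A : List Bool → ℝ} (hA : IsContinuousApriori A) (x : List Bool) :
    0 < A x := by
  obtain ⟨c, hc⟩ := hA.maximal _ isContinuousSemimeasure_uniform lowerSemicomputable_uniform
  have h := hc x
  refine (hA.semimeasure.nonneg x).lt_of_ne fun h0 => ?_
  rw [← h0, mul_zero] at h
  have : (0 : ℝ) < (1 / 2) ^ x.length := by positivity
  linarith

/-! ### Prefixes and Baire category -/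

lemma length_pre (ω : ℕ → Bool) (n : ℕ) : (pre ω n).length = n := by simp [pre]

lemma pre_congr {ω ω' : ℕ → Bool} {n : ℕ} (h : ∀ i < n, ω' i = ω i) : pre ω' n = pre ω n := by
  unfold pre
  exact List.map_congr_left fun i hi => h i (List.mem_range.1 hi)

lemma pre_getD (x : List Bool) : pre (fun i => x.getD i false) x.length = x := by
  apply List.ext_getElem
  · simp [pre]
  · intro i h1 h2
    simp [pre, h2]

lemma pre_length_of_prefix {x y : List Bool} (h : x <+: y) :
    pre (fun i => y.getD i false) x.length = x := by
  obtain ⟨t, rfl⟩ := h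
  rw [pre_congr (ω := fun i => x.getD i false), pre_getD]
  intro i hi
  simp [List.getElem?_append_left hi, hi]

/-- The sum of `f` over all prefixes of an infinite sequence. -/
noncomputable def prefixSum (f : List Bool → ℝ≥0∞) (ω : ℕ → Bool) : ℝ≥0∞ := ∑' n, f (pre ω n)

lemma lowerSemicontinuous_prefixSum (f : List Bool → ℝ≥0∞) :
    LowerSemicontinuous (prefixSum f) := by
  refine lowerSemicontinuous_tsum fun n ω y hy => ?_
  filter_upwards [(PiNat.isOpen_cylinder _ ω n).mem_nhds (PiNat.self_mem_cylinder ω n)] with ω' h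
  rw [pre_congr (PiNat.mem_cylinder_iff.1 h)]
  exact hy

/-- If the prefix sums are unbounded on every cylinder, then some prefix sum is infinite. -/
lemma exists_prefixSum_eq_top {f : List Bool → ℝ≥0∞}
    (h : ∀ (x : List Bool) (N : ℕ), ∃ ω, pre ω x.length = x ∧ (N : ℝ≥0∞) < prefixSum f ω) :
    ∃ ω, prefixSum f ω = ⊤ := by
  by_contra! hne
  have hcl : ∀ N : ℕ, IsClosed {ω | prefixSum f ω ≤ N} := fun N =>
    (lowerSemicontinuous_prefixSum f).isClosed_preimage N
  have hU : ⋃ N : ℕ, {ω | prefixSum f ω ≤ N} = Set.univ := by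
    refine Set.eq_univ_of_forall fun ω => Set.mem_iUnion.2 ?_
    obtain ⟨N, hN⟩ := ENNReal.exists_nat_gt (hne ω)
    exact ⟨N, hN.le⟩
  obtain ⟨N, ω, hω⟩ := nonempty_interior_of_iUnion_of_closed hcl hU
  obtain ⟨_, ⟨ω₀, n, rfl⟩, hmem, hsub⟩ :=
    (PiNat.isTopologicalBasis_cylinders fun _ : ℕ => Bool).exists_subset_of_mem_open hω
      isOpen_interior
  obtain ⟨ω', hpre, hlt⟩ := h (pre ω₀ n) N
  rw [length_pre] at hpre
  have hin : ω' ∈ PiNat.cylinder ω₀ n := by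
    rw [PiNat.mem_cylinder_iff]
    intro i hi
    exact List.map_inj_left.1 hpre i (List.mem_range.2 hi)
  exact absurd (interior_subset (hsub hin)) (not_le.2 hlt)

/-! ### Reduction to a sequence of requests -/

/-- The largest weight of a request for `x`. -/
noncomputable def requestSup (ev : Requests) (x : List Bool) : ℝ≥0∞ :=
  ⨆ (r : ℕ) (l : ℕ) (_ : ev r = some (x, l)), ENNReal.ofReal ((1 / 2) ^ l)

lemma le_requestSup {ev : Requests} {x : List Bool} {r l : ℕ} (h : ev r = some (x, l)) :
    ENNReal.ofReal ((1 / 2) ^ l) ≤ requestSup ev x :=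
  le_iSup_of_le r (le_iSup_of_le l (le_iSup_of_le h le_rfl))

/-- If `g` is at least the weight of every request, up to a constant factor, then its prefix sum
is infinite whenever that of the requests is. -/
lemma tsum_eq_top_of_dominates {ev : Requests} {A : List Bool → ℝ} (hA : ∀ x, 0 < A x)
    {ω : ℕ → Bool}
    (hω : prefixSum (fun x => requestSup ev x / ENNReal.ofReal (A x)) ω = ⊤)
    {g : List Bool → ℝ} {c : ℝ} (hc : 0 < c)
    (hg : ∀ r x l, ev r = some (x, l) → c * (1 / 2) ^ l ≤ g x * A x) :
    ∑' n, ENNReal.ofReal (g (pre ω n)) = ⊤ := by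
  have hle : ∀ x, ENNReal.ofReal c * (requestSup ev x / ENNReal.ofReal (A x)) ≤
      ENNReal.ofReal (g x) := by
    intro x
    rw [← mul_div_assoc]
    refine ENNReal.div_le_of_le_mul ?_
    unfold requestSup
    simp only [ENNReal.mul_iSup]
    refine iSup_le fun r => iSup_le fun l => iSup_le fun h => ?_
    rw [← ENNReal.ofReal_mul hc.le, ← ENNReal.ofReal_mul' (hA x).le]
    exact ENNReal.ofReal_le_ofReal (hg r x l h)
  refine top_le_iff.1 ?_
  calc (⊤ : ℝ≥0∞) = ENNReal.ofReal c *
        prefixSum (fun x => requestSup ev x / ENNReal.ofReal (A x)) ω := by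
        rw [hω, ENNReal.mul_top (by simpa using hc)]
    _ = ∑' n, ENNReal.ofReal c *
        (requestSup ev (pre ω n) / ENNReal.ofReal (A (pre ω n))) := ENNReal.tsum_mul_left.symm
    _ ≤ _ := ENNReal.tsum_le_tsum fun n => hle _

lemma tsum_discreteApriori_eq_top {ev : Requests} (hc : Computable ev) (hev : ev.KraftLe)
    {m A : List Bool → ℝ} (hm : IsDiscreteApriori m) (hA : ∀ x, 0 < A x) {ω : ℕ → Bool}
    (hω : prefixSum (fun x => requestSup ev x / ENNReal.ofReal (A x)) ω = ⊤) :
    ∑' n, ENNReal.ofReal (m (pre ω n) / A (pre ω n)) = ⊤ := by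
  obtain ⟨c, hcm⟩ := hm.maximal _ (isDiscreteSemimeasure_requestMeasure hev)
    (lowerSemicomputable_requestMeasure hev hc)
  -- Maximality does not say that `c` is positive.
  have hc1 : 0 < max c 1 := lt_max_of_lt_right one_pos
  refine tsum_eq_top_of_dominates (g := fun x => m x / A x) hA hω (inv_pos.2 hc1)
    fun r x l h => ?_
  rw [div_mul_cancel₀ _ (hA x).ne', inv_mul_le_iff₀ hc1]
  calc _ ≤ requestMeasure ev x := weight_le_requestMeasure hev h
    _ ≤ c * m x := hcm x
    _ ≤ max c 1 * m x :=
      mul_le_mul_of_nonneg_right (le_max_left _ _) (hm.semimeasure.nonneg x)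

lemma tsum_KA_sub_KP_eq_top {ev : Requests} (hc : Computable ev) (hev : ev.KraftLe)
    {D : List Bool →. List Bool} (hD : IsOptimalPrefixFreeMachine D)
    {A : List Bool → ℝ} (hA : ∀ x, 0 < A x) {ω : ℕ → Bool}
    (hω : prefixSum (fun x => requestSup ev x / ENNReal.ofReal (A x)) ω = ⊤) :
    ∑' n, ENNReal.ofReal ((2 : ℝ) ^ (KA A (pre ω n) - ((KP D (pre ω n)).toNat : ℝ))) = ⊤ := by
  obtain ⟨c, hcD⟩ := hD.optimal _ (isPrefixFreeMachine_requestMachine hc)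
  refine tsum_eq_top_of_dominates
    (g := fun x => (2 : ℝ) ^ (KA A x - ((KP D x).toNat : ℝ))) (c := (1 / 2) ^ (c + 1)) hA hω
    (by positivity) fun r x l h => ?_
  -- One bit is lost in the code and `c` bits by optimality. The bound also shows that `KP D x` is
  -- finite, so `toNat` does not take its default value on requested strings.
  have hle : KP D x ≤ ((l + 1 + c : ℕ) : ℕ∞) :=
    calc KP D x ≤ _ := hcD x
      _ ≤ ((l + 1 : ℕ) : ℕ∞) + c := by gcongr; exact KP_requestMachine_le hev h
      _ = _ := by push_cast; rfl
  have hnat : (KP D x).toNat ≤ l + 1 + c := ENat.toNat_le_of_le_natCast hle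
  have e : (2 : ℝ) ^ (KA A x - ((KP D x).toNat : ℝ)) * A x = (1 / 2) ^ (KP D x).toNat := by
    rw [Real.rpow_sub two_pos, KA, Real.rpow_neg two_pos.le,
      Real.rpow_logb two_pos (by norm_num) (hA x), Real.rpow_natCast, one_div, inv_pow]
    have := (hA x).ne'
    field_simp
  rw [e, ← pow_add]
  exact pow_le_pow_of_le_one (by norm_num) (by norm_num) (by omega)

/-! ### The strategy

Below a string `x₀` we build a sequence of requests such that the weights along some branch,
divided by `A`, have a sum of at least `T`, while the total weight is at most `2`.

The strategy keeps a stack of nodes `x₀ ⊏ y₀ ⊏ y₁ ⊏ …`, where each node is a `child` of the previous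
one and the node at depth `k` has received the weight `size T k` (in small units). A node is
abandoned as soon as `A` is large on it compared with the weight that was spent in its subtree;
then its parent gets a new child. -/

/-- The base `B` of the strategy is `2` to this power. -/
def baseExp (T : ℕ) : ℕ := 6 * T + 1

/-- The ratio `B` of the weights of a node and of its children. -/
def base (T : ℕ) : ℕ := 2 ^ baseExp T

/-- A node gets no more children if the weight spent below it exceeds its own by this factor. -/
def cap (T : ℕ) : ℕ := 2 ^ (6 * T)

/-- The maximal depth of a node. -/
def maxDepth (T : ℕ) : ℕ := base T * (T - 1)

/-- The weight of a node at depth `k`. -/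
def size (T k : ℕ) : ℕ := base T ^ (maxDepth T - k)

/-- The efficiency at depth `k`, multiplied by `B`. It is `T * B` at the top and `B` at the
maximal depth. -/
def rate (T k : ℕ) : ℕ := base T + maxDepth T - k

/-- A node: a string `x`, the weight `g` spent before its creation, and the numerator and the
denominator of the sum that is still to be gained from `x` on. -/
abbrev Frame := List Bool × ℕ × ℕ × ℕ

/-- The weight spent so far, and the stack of nodes, the deepest one first. -/
abbrev State := ℕ × List Frame

/-- The new node put on the stack `st` when the weight spent so far is `G`. -/
def newFrame (T : ℕ) (x₀ : List Bool) (G : ℕ) : List Frame → Frame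
  | [] => (child x₀ G, G, T, 1)
  -- The goal is multiplied by `1 - d / (2 w ρ)`, written with `rate = B ρ` to stay in `ℕ`. Every
  -- creation increases `G`, so the index `G` is never used twice.
  | f :: st => (child f.1 G, G,
      f.2.2.1 * (2 * (G - f.2.1) * rate T st.length - size T st.length * base T),
      f.2.2.2 * (2 * (G - f.2.1) * rate T st.length))

/-- The step made if no node is abandoned because of a large value of `A`. -/
def extend (T : ℕ) (x₀ : List Bool) (S : State) : State :=
  match S.2 with
  | [] => (S.1 + size T 0, [newFrame T x₀ S.1 []])
  | f :: st =>
    if st.length = maxDepth T then S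
    else if cap T * size T st.length ≤ S.1 - f.2.1 then (S.1, st)
    else (S.1 + size T (st.length + 1), newFrame T x₀ S.1 (f :: st) :: f :: st)

/-- The node `f` at depth `k` is abandoned if the approximation `P / (Q + 1)` of `A` is at least
the threshold determined by the weight `G - f.2.1` spent below it. -/
def Exceeds (T k G P Q : ℕ) (f : Frame) : Prop :=
  (Q + 1) * (rate T k * (G - f.2.1) * f.2.2.2) ≤ P * f.2.2.1 * base T ^ (maxDepth T + 2)

instance (T k G P Q : ℕ) (f : Frame) : Decidable (Exceeds T k G P Q f) :=
  inferInstanceAs (Decidable (_ ≤ _))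

/-- The step made when the `i`-th node of the stack is checked and the approximation of `A` on it
is `P / (Q + 1)`. -/
def update (T : ℕ) (x₀ : List Bool) (i P Q : ℕ) (S : State) : State :=
  match S.2.drop i with
  | [] => extend T x₀ S
  | f :: st => if Exceeds T st.length S.1 P Q f then (S.1, st) else extend T x₀ S

/-- The step made at time `s`, where `p x s / (q x s + 1)` is the approximation of `A x`. -/
def step (p q : List Bool → ℕ → ℕ) (T : ℕ) (x₀ : List Bool) (s : ℕ) (S : State) : State :=
  -- The first component of `s` takes each value infinitely often, so each stack position is checked
  -- with ever better approximations. If the position is empty, the default from `headI` is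
  -- irrelevant, as `update` then ignores `P` and `Q`.
  update T x₀ s.unpair.1 (p (S.2.drop s.unpair.1).headI.1 s) (q (S.2.drop s.unpair.1).headI.1 s) S

/-- The state at time `s`. -/
def run (p q : List Bool → ℕ → ℕ) (T : ℕ) (x₀ : List Bool) : ℕ → State
  | 0 => (0, [])
  | s + 1 => step p q T x₀ s (run p q T x₀ s)

/-- The request made in passing from the state `S` to `S'`. -/
def requestOf (T : ℕ) (S S' : State) : Option (List Bool × ℕ) :=
  if S.2.length < S'.2.length then some (S'.2.headI.1, baseExp T * S'.2.length) else none

/-! #### Parameters -/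

lemma base_pos (T : ℕ) : 0 < base T := by unfold base; positivity

lemma size_pos (T k : ℕ) : 0 < size T k := pow_pos (base_pos T) _

lemma base_mul_size {T k : ℕ} (h : k + 1 ≤ maxDepth T) :
    base T * size T (k + 1) = size T k := by
  unfold size
  rw [← pow_succ']
  congr 1
  omega

/-- The last child of a node is created below the cap and spends at most the node's own weight in
its subtree; the `+ 1` accounts for it. -/
lemma cap_add_one_le (T : ℕ) : cap T + 1 ≤ base T := by
  unfold cap base baseExp
  rw [pow_succ]
  have : 1 ≤ 2 ^ (6 * T) := Nat.one_le_two_pow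
  omega

lemma base_le_rate {T k : ℕ} (h : k ≤ maxDepth T) : base T ≤ rate T k := by
  unfold rate; omega

lemma rate_zero {T : ℕ} (hT : 1 ≤ T) : rate T 0 = T * base T := by
  obtain ⟨t, rfl⟩ : ∃ t, T = t + 1 := ⟨T - 1, by omega⟩
  unfold rate maxDepth
  simp only [Nat.add_sub_cancel, Nat.sub_zero]
  ring

lemma rate_le {T : ℕ} (hT : 1 ≤ T) (k : ℕ) : rate T k ≤ T * base T := by
  rw [← rate_zero hT]; unfold rate; omega

lemma rate_succ {T k : ℕ} (h : k + 1 ≤ maxDepth T) : rate T (k + 1) + 1 = rate T k := by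
  have := base_pos T
  unfold rate; omega

lemma rate_maxDepth (T : ℕ) : rate T (maxDepth T) = base T := by unfold rate; omega

/-- The constant `6` in `cap` is explained by `6 * log 2 > 4`. -/
lemma log_cap (T : ℕ) : 4 * (T : ℝ) ≤ Real.log (cap T) := by
  unfold cap
  push_cast
  rw [Real.log_pow]
  push_cast
  have := Real.log_two_gt_d9
  have hT : (0 : ℝ) ≤ T := Nat.cast_nonneg T
  nlinarith

/-! #### The invariant -/

/-- The efficiency at depth `k`. -/
noncomputable def eff (T k : ℕ) : ℝ := rate T k / base T

lemma one_le_eff {T k : ℕ} (h : k ≤ maxDepth T) : 1 ≤ eff T k := by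
  have hb : (0 : ℝ) < base T := by exact_mod_cast base_pos T
  rw [eff, le_div_iff₀ hb, one_mul]
  exact_mod_cast base_le_rate h

lemma eff_le {T : ℕ} (hT : 1 ≤ T) (k : ℕ) : eff T k ≤ T := by
  have hb : (0 : ℝ) < base T := by exact_mod_cast base_pos T
  rw [eff, div_le_iff₀ hb]
  exact_mod_cast rate_le hT k

lemma eff_zero {T : ℕ} (hT : 1 ≤ T) : eff T 0 = T := by
  have hb : (base T : ℝ) ≠ 0 := by exact_mod_cast (base_pos T).ne'
  rw [eff, rate_zero hT]
  push_cast
  field_simp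

lemma eff_succ {T k : ℕ} (h : k + 1 ≤ maxDepth T) : eff T (k + 1) = eff T k - 1 / base T := by
  have hb : (base T : ℝ) ≠ 0 := by exact_mod_cast (base_pos T).ne'
  rw [eff, eff, ← rate_succ h]
  push_cast
  field_simp
  ring

lemma eff_maxDepth (T : ℕ) : eff T (maxDepth T) = 1 := by
  have hb : (base T : ℝ) ≠ 0 := by exact_mod_cast (base_pos T).ne'
  rw [eff, rate_maxDepth, div_self hb]

/-- The sum that is still to be gained from a node on. -/
noncomputable def goal (f : Frame) : ℝ := f.2.2.1 / f.2.2.2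

/-- A lower bound for the value of `A` forced by spending the weight `w` below a node at
depth `k`, itself of weight `d`, if the efficiency is `ρ` at the node and `σ` at its children. -/
noncomputable def forced (σ ρ K d w : ℝ) : ℝ :=
  σ / K * (w - d + d / (2 * ρ) * (Real.log w - Real.log d))

/-- Induction step for the invariant: the last term is what `A` must be on a child, created when `w`
was spent, that is abandoned after `v` more. With `u = d / (2wρ)`, the increment of the logarithm is
at most `v / w`, and `1 + u ≤ 1 / (1 - u)`. -/
lemma forced_add_sub_le {σ ρ K d w v : ℝ} (hσ : 0 ≤ σ) (hρ : 1 ≤ ρ) (hK : 0 < K) (hd : 0 < d)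
    (hw : d ≤ w) (hv : 0 < v) :
    forced σ ρ K d (w + v) ≤ forced σ ρ K d w + σ / (K * (1 - d / (2 * w * ρ))) * v := by
  have hw0 : 0 < w := hd.trans_le hw
  have hρ0 : 0 < ρ := by linarith
  set u := d / (2 * w * ρ) with hu
  have hu0 : 0 ≤ u := by positivity
  have hu1 : u < 1 := by
    rw [hu, div_lt_one (by positivity)]
    nlinarith
  have hlog : Real.log (w + v) - Real.log w ≤ v / w := by
    rw [← Real.log_div (by positivity) hw0.ne']
    have := Real.log_le_sub_one_of_pos (show 0 < (w + v) / w by positivity)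
    have e : (w + v) / w - 1 = v / w := by field_simp; ring
    linarith
  have h1 : d / (2 * ρ) * (Real.log (w + v) - Real.log w) ≤ u * v := by
    have : d / (2 * ρ) * (v / w) = u * v := by rw [hu]; field_simp
    rw [← this]
    gcongr
  have h2 : 1 + u ≤ 1 / (1 - u) := by
    rw [le_div_iff₀ (by linarith)]
    nlinarith
  have hσK : 0 ≤ σ / K := by positivity
  calc forced σ ρ K d (w + v)
      = forced σ ρ K d w
        + σ / K * (v + d / (2 * ρ) * (Real.log (w + v) - Real.log w)) := by
        unfold forced; ring
    _ ≤ forced σ ρ K d w + σ / K * (v + u * v) := by gcongr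
    _ = forced σ ρ K d w + σ / K * ((1 + u) * v) := by ring
    _ ≤ forced σ ρ K d w + σ / K * (1 / (1 - u) * v) := by gcongr
    _ = _ := by
        have : 1 - u ≠ 0 := by linarith
        field_simp

/-- The logarithmic term is at least `2 * d`: one `d` cancels `-d`, the other pays for `(ρ - σ) * w
= w / B ≤ d`. -/
lemma le_forced {B σ ρ K d w t : ℝ} (hB : 0 < B) (hσ : 1 ≤ σ) (hρσ : σ = ρ - 1 / B) (hK : 0 < K)
    (hd : 0 < d) (hwB : w ≤ B * d) (hρt : ρ ≤ t)
    (hlog : 4 * t ≤ Real.log w - Real.log d) : ρ / K * w ≤ forced σ ρ K d w := by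
  have hB' : 0 < 1 / B := by positivity
  have hρ0 : 0 < ρ := by linarith
  have h1 : 2 * d ≤ d / (2 * ρ) * (Real.log w - Real.log d) := by
    rw [div_mul_eq_mul_div, le_div_iff₀ (by positivity)]
    nlinarith
  have h2 : w / B ≤ d := by rw [div_le_iff₀ hB]; linarith
  have h3 : ρ * w ≤ σ * (w - d + d / (2 * ρ) * (Real.log w - Real.log d)) := by
    have : σ * (w + d) ≤ σ * (w - d + d / (2 * ρ) * (Real.log w - Real.log d)) := by
      exact mul_le_mul_of_nonneg_left (by linarith) (by linarith)
    have e : ρ * w = σ * w + w / B := by rw [hρσ]; ring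
    nlinarith
  calc ρ / K * w = (ρ * w) / K := by ring
    _ ≤ (σ * (w - d + d / (2 * ρ) * (Real.log w - Real.log d))) / K := by gcongr
    _ = _ := by unfold forced; ring

/-- The invariant of the strategy, when the weight spent is `h`: `A` is large enough on the
abandoned children of every node. -/
def Inv (A : List Bool → ℝ) (T : ℕ) (x₀ : List Bool) : ℕ → List Frame → Prop
  | h, [] => (h : ℝ) ≤ ∑ i ∈ Finset.range h, A (child x₀ i)
  -- For the ancestors the inequality is kept only at the time `f` was created: what is spent below
  -- `f` is charged to its parent when `f` is abandoned.
  | h, f :: st => (Inv A T x₀ f.2.1 st ∧ f = newFrame T x₀ f.2.1 st ∧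
      (∀ f' st', st = f' :: st' → f.2.1 < f'.2.1 + cap T * size T st'.length) ∧
      0 < f.2.2.1 ∧ 0 < f.2.2.2 ∧ st.length ≤ maxDepth T ∧
      f.2.1 + size T st.length ≤ h ∧ h ≤ f.2.1 + base T * size T st.length ∧
      (st.length = maxDepth T → h = f.2.1 + size T st.length)) ∧
      forced (eff T (st.length + 1)) (eff T st.length) (goal f) (size T st.length)
        ((h : ℝ) - f.2.1) ≤ ∑ i ∈ Finset.range h, A (child f.1 i)

/-- The part of the invariant for the node `f` that does not speak of its children. -/
structure FrameOk (A : List Bool → ℝ) (T : ℕ) (x₀ : List Bool) (h : ℕ) (f : Frame)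
    (st : List Frame) : Prop where
  inv : Inv A T x₀ f.2.1 st
  eq_newFrame : f = newFrame T x₀ f.2.1 st
  lt_cap : ∀ f' st', st = f' :: st' → f.2.1 < f'.2.1 + cap T * size T st'.length
  num_pos : 0 < f.2.2.1
  den_pos : 0 < f.2.2.2
  length_le : st.length ≤ maxDepth T
  add_size_le : f.2.1 + size T st.length ≤ h
  le_add : h ≤ f.2.1 + base T * size T st.length
  eq_of_leaf : st.length = maxDepth T → h = f.2.1 + size T st.length

/-! ### Preservation of the invariant -/

section
variable {A : List Bool → ℝ} {T : ℕ} {x₀ : List Bool} {h : ℕ} {f : Frame} {st : List Frame}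

lemma inv_cons : Inv A T x₀ h (f :: st) ↔ FrameOk A T x₀ h f st ∧
    forced (eff T (st.length + 1)) (eff T st.length) (goal f) (size T st.length)
        ((h : ℝ) - f.2.1) ≤ ∑ i ∈ Finset.range h, A (child f.1 i) := by
  rw [Inv]
  constructor
  · rintro ⟨⟨h1, h2, h3, h4, h5, h6, h7, h8, h9⟩, h10⟩
    exact ⟨⟨h1, h2, h3, h4, h5, h6, h7, h8, h9⟩, h10⟩
  · rintro ⟨⟨h1, h2, h3, h4, h5, h6, h7, h8, h9⟩, h10⟩
    exact ⟨⟨h1, h2, h3, h4, h5, h6, h7, h8, h9⟩, h10⟩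

lemma FrameOk.goal_pos (H : FrameOk A T x₀ h f st) : 0 < goal f := by
  have h1 : (0 : ℝ) < f.2.2.1 := by exact_mod_cast H.num_pos
  have h2 : (0 : ℝ) < f.2.2.2 := by exact_mod_cast H.den_pos
  exact div_pos h1 h2

lemma FrameOk.size_le (H : FrameOk A T x₀ h f st) : (size T st.length : ℝ) ≤ (h : ℝ) - f.2.1 := by
  have : ((f.2.1 + size T st.length : ℕ) : ℝ) ≤ h := by exact_mod_cast H.add_size_le
  push_cast at this
  linarith

/-- When `f` was created, its parent, of weight `d`, had spent less than `cap * d`; the subtree of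
`f` adds at most `B * size (k + 1) = d`. -/
lemma FrameOk.parent {f' : Frame} (H : FrameOk A T x₀ h f (f' :: st)) :
    FrameOk A T x₀ h f' st := by
  obtain ⟨P, -⟩ := inv_cons.1 H.inv
  have hl := H.length_le
  rw [List.length_cons] at hl
  have h1 := H.le_add
  rw [List.length_cons, base_mul_size hl] at h1
  have h2 := H.lt_cap f' st rfl
  have h3 := H.add_size_le
  have h4 := P.add_size_le
  have h5 := Nat.mul_le_mul_right (size T st.length) (cap_add_one_le T)
  rw [add_mul, one_mul] at h5
  exact ⟨P.inv, P.eq_newFrame, P.lt_cap, P.num_pos, P.den_pos, P.length_le, by omega, by omega,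
    fun h => by omega⟩

lemma FrameOk.of_drop (H : ∀ f' st', st = f' :: st' → FrameOk A T x₀ h f' st') (i : ℕ)
    {f : Frame} {st₁ : List Frame} (hd : st.drop i = f :: st₁) : FrameOk A T x₀ h f st₁ := by
  induction i generalizing st with
  | zero => exact H _ _ (by simpa using hd)
  | succ i ih =>
    cases st with
    | nil => simp at hd
    | cons f' st' =>
      rw [List.drop_succ_cons] at hd
      refine ih (fun f₂ st₂ e => ?_) hd
      subst e
      exact (H _ _ rfl).parent

lemma Inv.frameOk_of_drop (H : Inv A T x₀ h st) {i : ℕ} {st₁ : List Frame}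
    (hd : st.drop i = f :: st₁) : FrameOk A T x₀ h f st₁ := by
  refine FrameOk.of_drop (fun f' st' e => ?_) i hd
  subst e
  exact (inv_cons.1 H).1

lemma FrameOk.goal_eq {f' : Frame} (H : FrameOk A T x₀ h f (f' :: st)) :
    goal f = goal f' * (1 - size T st.length / (2 * ((f.2.1 : ℝ) - f'.2.1) * eff T st.length)) := by
  obtain ⟨P, -⟩ := inv_cons.1 H.inv
  have h1 := P.add_size_le
  have h2 := base_le_rate P.length_le
  have h3 := base_pos T
  have h4 := size_pos T st.length
  have hw : size T st.length ≤ f.2.1 - f'.2.1 := by omega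
  -- The subtraction in `newFrame` is not truncated, because `d ≤ w` and `ρ ≥ 1`.
  have hle : size T st.length * base T ≤ 2 * (f.2.1 - f'.2.1) * rate T st.length :=
    Nat.mul_le_mul (by omega) h2
  have e := congrArg (fun y : Frame => y.2.2) H.eq_newFrame
  simp only [newFrame] at e
  have hden := P.den_pos
  have hw' : (0 : ℝ) < (f.2.1 : ℝ) - f'.2.1 := lt_of_lt_of_le (by exact_mod_cast h4) P.size_le
  have hb : (0 : ℝ) < base T := by exact_mod_cast h3
  have hr : (0 : ℝ) < rate T st.length := by exact_mod_cast h3.trans_le h2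
  have hd : (0 : ℝ) < f'.2.2.2 := by exact_mod_cast hden
  unfold goal
  rw [e]
  simp only
  push_cast [Nat.cast_sub hle, Nat.cast_sub (show f'.2.1 ≤ f.2.1 by omega)]
  unfold eff
  field_simp

/-- If `A` is large on the node `f`, then `f` can be abandoned. -/
lemma FrameOk.inv_tail (hT : 1 ≤ T) (hA : ∀ x, 0 ≤ A x) (H : FrameOk A T x₀ h f st)
    (hf : eff T st.length / goal f * ((h : ℝ) - f.2.1) ≤ A f.1) : Inv A T x₀ h st := by
  have hs := size_pos T st.length
  have hlt : f.2.1 < h := by have := H.add_size_le; omega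
  -- The index of `f` among its siblings is `f.2.1 < h`, so `A f.1` is a new term of the parent's
  -- sum.
  have hsum : ∀ x, ∑ i ∈ Finset.range f.2.1, A (child x i) + A (child x f.2.1) ≤
      ∑ i ∈ Finset.range h, A (child x i) := by
    intro x
    rw [← Finset.sum_range_succ]
    exact Finset.sum_le_sum_of_subset_of_nonneg
      (Finset.range_subset_range.2 hlt) (fun _ _ _ => hA _)
  cases st with
  | nil =>
    have hinv : ((f.2.1 : ℕ) : ℝ) ≤ ∑ i ∈ Finset.range f.2.1, A (child x₀ i) := by
      simpa only [Inv] using H.inv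
    have e := H.eq_newFrame
    have e1 : f.1 = child x₀ f.2.1 := congrArg Prod.fst e
    have e2 : goal f = T := by
      have := congrArg (fun y : Frame => y.2.2) e
      simp only [newFrame] at this
      simp [goal, this]
    have hT0 : (T : ℝ) ≠ 0 := by exact_mod_cast (by omega : T ≠ 0)
    rw [e2, List.length_nil, eff_zero hT, div_self hT0, one_mul, e1] at hf
    simp only [Inv]
    linarith [hsum x₀]
  | cons f' st' =>
    obtain ⟨P, hforced⟩ := inv_cons.1 H.inv
    refine inv_cons.2 ⟨H.parent, ?_⟩
    have e1 : f.1 = child f'.1 f.2.1 := congrArg Prod.fst H.eq_newFrame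
    rw [List.length_cons, H.goal_eq, e1] at hf
    have hl := H.length_le
    rw [List.length_cons] at hl
    have hv : (0 : ℝ) < (h : ℝ) - f.2.1 := by
      have : (f.2.1 : ℝ) < h := by exact_mod_cast hlt
      linarith
    have := forced_add_sub_le (σ := eff T (st'.length + 1)) (ρ := eff T st'.length) (K := goal f')
      (d := size T st'.length) (w := (f.2.1 : ℝ) - f'.2.1) (v := (h : ℝ) - f.2.1)
      (by linarith [one_le_eff hl]) (one_le_eff P.length_le) P.goal_pos
      (by exact_mod_cast size_pos T _) P.size_le hv
    rw [show (f.2.1 : ℝ) - f'.2.1 + ((h : ℝ) - f.2.1) = (h : ℝ) - f'.2.1 by ring] at this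
    linarith [hsum f'.1]

lemma newFrame_g (T : ℕ) (x₀ : List Bool) (G : ℕ) (st : List Frame) :
    (newFrame T x₀ G st).2.1 = G := by
  cases st <;> rfl

/-- A new node has `w = d`, where `forced` vanishes, so nothing is required of its children yet. -/
lemma inv_push (hT : 1 ≤ T) (hA : ∀ x, 0 ≤ A x) (H : Inv A T x₀ h st)
    (hl : st.length ≤ maxDepth T)
    (hcap : ∀ f' st', st = f' :: st' → h < f'.2.1 + cap T * size T st'.length) :
    Inv A T x₀ (h + size T st.length) (newFrame T x₀ h st :: st) := by
  have hb := base_pos T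
  have hpos : 0 < (newFrame T x₀ h st).2.2.1 ∧ 0 < (newFrame T x₀ h st).2.2.2 := by
    cases st with
    | nil => exact ⟨hT, one_pos⟩
    | cons f' st' =>
      obtain ⟨P, -⟩ := inv_cons.1 H
      have h1 := P.add_size_le
      have h2 := base_le_rate P.length_le
      have h4 := size_pos T st'.length
      have hlt : size T st'.length * base T < 2 * (h - f'.2.1) * rate T st'.length := by
        calc size T st'.length * base T < (2 * (h - f'.2.1)) * base T :=
              Nat.mul_lt_mul_of_pos_right (by omega) hb
          _ ≤ _ := Nat.mul_le_mul_left _ h2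
      exact ⟨Nat.mul_pos P.num_pos (by omega), Nat.mul_pos P.den_pos (by omega)⟩
  refine inv_cons.2 ⟨⟨?_, ?_, ?_, hpos.1, hpos.2, hl, ?_, ?_, ?_⟩, ?_⟩
  · rwa [newFrame_g]
  · rw [newFrame_g]
  · rwa [newFrame_g]
  · rw [newFrame_g]
  · rw [newFrame_g]
    exact Nat.add_le_add_left (Nat.le_mul_of_pos_left _ hb) _
  · rw [newFrame_g]
    exact fun _ => rfl
  · rw [newFrame_g]
    have e : (((h + size T st.length : ℕ) : ℝ) - h) = size T st.length := by push_cast; ring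
    rw [e, forced, sub_self, sub_self, mul_zero, add_zero, mul_zero]
    exact Finset.sum_nonneg fun _ _ => hA _

lemma inv_extend (hT : 1 ≤ T) (hA : ∀ x, 0 ≤ A x)
    (hsum : ∀ x n, ∑ i ∈ Finset.range n, A (child x i) ≤ A x) {S : State}
    (H : Inv A T x₀ S.1 S.2) : Inv A T x₀ (extend T x₀ S).1 (extend T x₀ S).2 := by
  obtain ⟨G, st⟩ := S
  simp only at H
  cases st with
  | nil =>
    exact inv_push hT hA H (Nat.zero_le _) (fun _ _ h => by simp at h)
  | cons f st =>
    obtain ⟨P, hforced⟩ := inv_cons.1 H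
    simp only [extend]
    split_ifs with h1 h2
    · exact H
    -- At the cap the abandoned children alone force `A` above the threshold on the node, without
    -- consulting the approximation.
    · refine P.inv_tail hT hA ?_
      have hl : st.length + 1 ≤ maxDepth T := by have := P.length_le; omega
      have hs : (0 : ℝ) < size T st.length := by exact_mod_cast size_pos T _
      have hg : f.2.1 ≤ G := by have := P.add_size_le; omega
      have hw : (cap T : ℝ) * size T st.length ≤ (G : ℝ) - f.2.1 := by
        rw [← Nat.cast_sub hg]
        exact_mod_cast h2
      have hcap : (0 : ℝ) < cap T := by unfold cap; positivity
      have hup : (G : ℝ) - f.2.1 ≤ base T * size T st.length := by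
        have : (G : ℝ) ≤ ((f.2.1 + base T * size T st.length : ℕ) : ℝ) := by
          exact_mod_cast P.le_add
        push_cast at this
        linarith
      refine (le_forced (B := base T) (t := T) (by exact_mod_cast base_pos T) (one_le_eff hl)
        (eff_succ hl) P.goal_pos hs hup (eff_le hT _) ?_).trans
        (hforced.trans (hsum _ _))
      have h3 := Real.log_le_log (by positivity) hw
      rw [Real.log_mul hcap.ne' hs.ne'] at h3
      linarith [log_cap T]
    · have hl : st.length + 1 ≤ maxDepth T := by have := P.length_le; omega
      refine inv_push hT hA H hl ?_
      rintro f' st' ⟨rfl, rfl⟩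
      have := P.add_size_le
      omega

end

/-- The exponent `maxDepth T + 2` combines the unit `B ^ (maxDepth T + 1)` with the denominator `B`
of `eff`. -/
lemma exceeds_iff {T k G P Q : ℕ} {f : Frame} (hg : f.2.1 ≤ G) (hn : 0 < f.2.2.1)
    (hd : 0 < f.2.2.2) : Exceeds T k G P Q f ↔
    eff T k / goal f * ((G : ℝ) - f.2.1) ≤ (P : ℝ) / (Q + 1) * base T ^ (maxDepth T + 1) := by
  have hn' : (0 : ℝ) < f.2.2.1 := by exact_mod_cast hn
  have hd' : (0 : ℝ) < f.2.2.2 := by exact_mod_cast hd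
  have hb : (0 : ℝ) < base T := by exact_mod_cast base_pos T
  have e1 : eff T k / goal f * ((G : ℝ) - f.2.1) =
      (rate T k * ((G : ℝ) - f.2.1) * f.2.2.2) / (f.2.2.1 * base T) := by
    unfold eff goal; field_simp
  have e2 : (P : ℝ) / (Q + 1) * base T ^ (maxDepth T + 1) =
      (P * base T ^ (maxDepth T + 1)) / (Q + 1) := by ring
  rw [e1, e2, div_le_div_iff₀ (by positivity) (by positivity), Exceeds,
    ← Nat.cast_le (α := ℝ)]
  push_cast [Nat.cast_sub hg]
  constructor <;> intro h
  · calc _ = _ := by ring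
      _ ≤ _ := h
      _ = _ := by ring
  · calc _ = _ := by ring
      _ ≤ _ := h
      _ = _ := by ring

/-! #### The run of the strategy -/

lemma extend_cases (T : ℕ) (x₀ : List Bool) {S : State} (hl : S.2.length ≤ maxDepth T + 1) :
    ((extend T x₀ S).1 = S.1 ∧ (extend T x₀ S).2 <:+ S.2) ∨
      (extend T x₀ S = (S.1 + size T S.2.length, newFrame T x₀ S.1 S.2 :: S.2) ∧
        S.2.length ≤ maxDepth T) := by
  obtain ⟨G, st⟩ := S
  cases st with
  | nil => exact Or.inr ⟨rfl, Nat.zero_le _⟩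
  | cons f st =>
    simp only [List.length_cons] at hl
    simp only [extend]
    split_ifs with h1 h2
    · exact Or.inl ⟨rfl, List.suffix_refl _⟩
    · exact Or.inl ⟨rfl, List.suffix_cons _ _⟩
    · exact Or.inr ⟨rfl, by simp only [List.length_cons]; omega⟩

lemma update_cases (T : ℕ) (x₀ : List Bool) (i P Q : ℕ) {S : State}
    (hl : S.2.length ≤ maxDepth T + 1) :
    ((update T x₀ i P Q S).1 = S.1 ∧ (update T x₀ i P Q S).2 <:+ S.2) ∨
      (update T x₀ i P Q S = (S.1 + size T S.2.length, newFrame T x₀ S.1 S.2 :: S.2) ∧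
        S.2.length ≤ maxDepth T) := by
  unfold update
  split
  · exact extend_cases T x₀ hl
  · rename_i f st hd
    split_ifs
    · refine Or.inl ⟨rfl, ?_⟩
      exact (List.suffix_cons f st).trans (hd ▸ List.drop_suffix i S.2)
    · exact extend_cases T x₀ hl

section
variable (p q : List Bool → ℕ → ℕ) (T : ℕ) (x₀ : List Bool)

lemma length_run_le (s : ℕ) : (run p q T x₀ s).2.length ≤ maxDepth T + 1 := by
  induction s with
  | zero => simp [run]
  | succ s ih =>
    rw [run, step]
    rcases update_cases T x₀ s.unpair.1 (p ((run p q T x₀ s).2.drop s.unpair.1).headI.1 s)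
      (q ((run p q T x₀ s).2.drop s.unpair.1).headI.1 s) ih with h | h
    · exact h.2.length_le.trans ih
    · rw [h.1]
      simpa using h.2

lemma run_succ_cases (s : ℕ) :
    ((run p q T x₀ (s + 1)).1 = (run p q T x₀ s).1 ∧
      (run p q T x₀ (s + 1)).2 <:+ (run p q T x₀ s).2) ∨
    (run p q T x₀ (s + 1) = ((run p q T x₀ s).1 + size T (run p q T x₀ s).2.length,
        newFrame T x₀ (run p q T x₀ s).1 (run p q T x₀ s).2 :: (run p q T x₀ s).2) ∧
      (run p q T x₀ s).2.length ≤ maxDepth T) :=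
  update_cases T x₀ _ _ _ (length_run_le p q T x₀ s)

/-- The request made at time `s`. -/
def request (s : ℕ) : Option (List Bool × ℕ) :=
  requestOf T (run p q T x₀ s) (run p q T x₀ (s + 1))

lemma half_pow_baseExp_mul {T k : ℕ} (hk : k ≤ maxDepth T) :
    (1 / 2 : ℝ) ^ (baseExp T * (k + 1)) = size T k / base T ^ (maxDepth T + 1) := by
  have hb : (base T : ℝ) ≠ 0 := by exact_mod_cast (base_pos T).ne'
  have e1 : (1 / 2 : ℝ) ^ (baseExp T * (k + 1)) = ((base T : ℝ) ^ (k + 1))⁻¹ := by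
    rw [one_div, inv_pow, pow_mul]
    simp [base]
  have e2 : (base T : ℝ) ^ (maxDepth T + 1) = size T k * base T ^ (k + 1) := by
    unfold size
    push_cast
    rw [← pow_add]
    congr 1
    omega
  have hs : (size T k : ℝ) ≠ 0 := by exact_mod_cast (size_pos T k).ne'
  rw [e1, e2]
  field_simp

lemma sum_weight_request (n : ℕ) :
    ∑ s ∈ Finset.range n, weight (lengthOf (request p q T x₀ s)) =
      (run p q T x₀ n).1 / base T ^ (maxDepth T + 1) := by
  induction n with
  | zero => simp [run]
  | succ n ih =>
    rw [Finset.sum_range_succ, ih, request, requestOf]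
    rcases run_succ_cases p q T x₀ n with h | h
    · rw [if_neg (not_lt.2 h.2.length_le), h.1]
      simp [lengthOf, weight]
    · rw [h.1, if_pos (by simp)]
      simp only [lengthOf, Option.map_some, weight, List.length_cons]
      rw [half_pow_baseExp_mul h.2]
      push_cast
      ring

/-- Every node on the stack has been requested. -/
lemma exists_request_of_suffix {s : ℕ} {f : Frame} {st : List Frame}
    (h : (f :: st) <:+ (run p q T x₀ s).2) :
    ∃ r, request p q T x₀ r = some (f.1, baseExp T * (st.length + 1)) := by
  induction s with
  | zero => simp [run] at h
  | succ s ih =>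
    rcases run_succ_cases p q T x₀ s with h' | h'
    · exact ih (h.trans h'.2)
    · rw [h'.1] at h
      rcases List.suffix_cons_iff.1 h with h2 | h2
      · refine ⟨s, ?_⟩
        obtain ⟨rfl, rfl⟩ := List.cons.inj h2
        rw [request, requestOf, h'.1, if_pos (by simp)]
        simp
      · exact ih h2

end

/-- The data of an approximation from below of a continuous semimeasure. -/
structure Approximates (p q : List Bool → ℕ → ℕ) (A : List Bool → ℝ) : Prop where
  semimeasure : IsContinuousSemimeasure A
  mono : ∀ x, Monotone fun n => (p x n : ℝ) / ((q x n : ℝ) + 1)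
  tendsto : ∀ x, Filter.Tendsto (fun n => (p x n : ℝ) / ((q x n : ℝ) + 1)) Filter.atTop
    (nhds (A x))

/-! ### Total weight, termination and gain of one strategy -/

section
variable {p q : List Bool → ℕ → ℕ} {A : List Bool → ℝ} {T : ℕ}

/-- The semimeasure `A` in the units of the strategy. -/
noncomputable def scaled (A : List Bool → ℝ) (T : ℕ) (x : List Bool) : ℝ :=
  A x * base T ^ (maxDepth T + 1)

lemma scaled_nonneg (h : IsContinuousSemimeasure A) (x : List Bool) : 0 ≤ scaled A T x :=
  mul_nonneg (h.nonneg x) (by positivity)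

lemma sum_scaled_child_le (h : IsContinuousSemimeasure A) (x : List Bool) (n : ℕ) :
    ∑ i ∈ Finset.range n, scaled A T (child x i) ≤ scaled A T x := by
  unfold scaled
  rw [← Finset.sum_mul]
  exact mul_le_mul_of_nonneg_right (h.sum_child_le x n) (by positivity)

lemma inv_run (hp : Approximates p q A) (hT : 1 ≤ T) (x₀ : List Bool) (s : ℕ) :
    Inv (scaled A T) T x₀ (run p q T x₀ s).1 (run p q T x₀ s).2 := by
  have hA := scaled_nonneg (T := T) hp.semimeasure
  induction s with
  | zero => simp [run, Inv]
  | succ s ih =>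
    have hext := inv_extend hT hA (sum_scaled_child_le hp.semimeasure) ih
    rw [run, step, update]
    split
    · exact hext
    · rename_i f st hd
      split_ifs with hex
      · have P := ih.frameOk_of_drop hd
        rw [exceeds_iff (by have := P.add_size_le; omega) P.num_pos P.den_pos] at hex
        refine P.inv_tail hT hA (hex.trans ?_)
        rw [hd, List.headI_cons]
        exact mul_le_mul_of_nonneg_right ((hp.mono f.1).ge_of_tendsto (hp.tendsto f.1) s)
          (by positivity)
      · exact hext

/-- Descending to depth `0`: before that node the invariant bounds the weight by `A x₀ ≤ 1`, and
below it at most `B * size 0`, again one unit, is spent. -/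
lemma FrameOk.le_two_mul {x₀ : List Bool} {G : ℕ} {f : Frame} {st : List Frame}
    (h : IsContinuousSemimeasure A) (H : FrameOk (scaled A T) T x₀ G f st) :
    G ≤ 2 * base T ^ (maxDepth T + 1) := by
  induction st generalizing f with
  | nil =>
    have h1 : ((f.2.1 : ℕ) : ℝ) ≤ ∑ i ∈ Finset.range f.2.1, scaled A T (child x₀ i) := by
      simpa only [Inv] using H.inv
    have h2 : (f.2.1 : ℝ) ≤ base T ^ (maxDepth T + 1) :=
      (h1.trans (sum_scaled_child_le h x₀ _)).trans
        (mul_le_of_le_one_left (by positivity) (h.le_one x₀))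
    have h3 : f.2.1 ≤ base T ^ (maxDepth T + 1) := by exact_mod_cast h2
    have h4 := H.le_add
    have e : base T * size T ([] : List Frame).length = base T ^ (maxDepth T + 1) := by
      simp [size, pow_succ']
    rw [e] at h4
    omega
  | cons f' st ih => exact ih H.parent

lemma run_fst_le (hp : Approximates p q A) (hT : 1 ≤ T) (x₀ : List Bool) (s : ℕ) :
    (run p q T x₀ s).1 ≤ 2 * base T ^ (maxDepth T + 1) := by
  have H := inv_run hp hT x₀ s
  cases hst : (run p q T x₀ s).2 with
  | nil =>
    rw [hst] at H
    have h1 : (((run p q T x₀ s).1 : ℕ) : ℝ) ≤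
        ∑ i ∈ Finset.range (run p q T x₀ s).1, scaled A T (child x₀ i) := by
      simpa only [Inv] using H
    have h2 : ((run p q T x₀ s).1 : ℝ) ≤ base T ^ (maxDepth T + 1) :=
      (h1.trans (sum_scaled_child_le hp.semimeasure x₀ _)).trans
        (mul_le_of_le_one_left (by positivity) (hp.semimeasure.le_one x₀))
    have h3 : (run p q T x₀ s).1 ≤ base T ^ (maxDepth T + 1) := by exact_mod_cast h2
    omega
  | cons f st =>
    rw [hst] at H
    exact (inv_cons.1 H).1.le_two_mul hp.semimeasure

lemma sum_weight_request_le (hp : Approximates p q A) (hT : 1 ≤ T) (x₀ : List Bool) (n : ℕ) :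
    ∑ s ∈ Finset.range n, weight (lengthOf (request p q T x₀ s)) ≤ 2 := by
  have hb : (0 : ℝ) < base T := by exact_mod_cast base_pos T
  rw [sum_weight_request, div_le_iff₀ (by positivity)]
  exact_mod_cast run_fst_le hp hT x₀ n

/-- A quantity that increases with every change of the state. -/
def progress (T : ℕ) (S : State) : ℕ := (maxDepth T + 2) * S.1 + (maxDepth T + 1 - S.2.length)

lemma progress_run_succ (x₀ : List Bool) (s : ℕ) :
    run p q T x₀ (s + 1) = run p q T x₀ s ∨
      progress T (run p q T x₀ s) < progress T (run p q T x₀ (s + 1)) := by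
  have hl := length_run_le p q T x₀ s
  unfold progress
  rcases run_succ_cases p q T x₀ s with h | h
  · rcases h.2.length_le.lt_or_eq with hlt | heq
    · right
      rw [h.1]
      omega
    · exact Or.inl (Prod.ext h.1 (h.2.eq_of_length heq))
  · right
    rw [h.1]
    simp only [List.length_cons]
    -- A new node adds at least `maxDepth T + 2` through the weight and loses only one through the
    -- height.
    have h1 : (maxDepth T + 2) * 1 ≤ (maxDepth T + 2) * size T (run p q T x₀ s).2.length :=
      Nat.mul_le_mul_left _ (size_pos T _)
    rw [mul_add]
    omega

lemma exists_run_eq (hp : Approximates p q A) (hT : 1 ≤ T) (x₀ : List Bool) :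
    ∃ s₀, ∀ s, s₀ ≤ s → run p q T x₀ s = run p q T x₀ s₀ := by
  have hbdd : BddAbove (Set.range fun s => progress T (run p q T x₀ s)) := by
    refine ⟨(maxDepth T + 2) * (2 * base T ^ (maxDepth T + 1)) + (maxDepth T + 1), ?_⟩
    rintro _ ⟨s, rfl⟩
    exact Nat.add_le_add (Nat.mul_le_mul_left _ (run_fst_le hp hT x₀ s)) (Nat.sub_le _ _)
  obtain ⟨s₀, hs₀⟩ := Nat.sSup_mem (Set.range_nonempty _) hbdd
  have hmax : ∀ s, progress T (run p q T x₀ s) ≤ progress T (run p q T x₀ s₀) := fun s => by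
    simp only at hs₀
    rw [hs₀]
    exact le_csSup hbdd ⟨s, rfl⟩
  refine ⟨s₀, fun s hs => ?_⟩
  induction s, hs using Nat.le_induction with
  | base => rfl
  | succ s hs ih =>
    rcases progress_run_succ (p := p) (q := q) (T := T) x₀ s with h | h
    · rw [h, ih]
    · rw [ih] at h
      exact absurd (hmax (s + 1)) (not_le.2 h)

lemma extend_eq_self {x₀ : List Bool} {S : State} (h : extend T x₀ S = S) :
    ∃ f st, S.2 = f :: st ∧ st.length = maxDepth T := by
  obtain ⟨G, st⟩ := S
  cases st with
  | nil =>
    have := congrArg (fun S : State => S.2.length) h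
    simp [extend] at this
  | cons f st =>
    refine ⟨f, st, rfl, ?_⟩
    by_contra hne
    have := congrArg (fun S : State => S.2.length) h
    simp only [extend, if_neg hne] at this
    split_ifs at this <;> simp at this

lemma eq_extend_of_update_eq_self {x₀ : List Bool} {i P Q : ℕ} {S : State}
    (h : update T x₀ i P Q S = S) :
    extend T x₀ S = S ∧ ∀ f st, S.2.drop i = f :: st → ¬ Exceeds T st.length S.1 P Q f := by
  unfold update at h
  split at h
  · rename_i hd
    exact ⟨h, fun f st e => by rw [hd] at e; simp at e⟩
  · rename_i f st hd
    split_ifs at h with hex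
    · exfalso
      have h1 := (List.drop_suffix i S.2).length_le
      have h2 := congrArg (fun S : State => S.2.length) h
      rw [hd] at h1
      simp only [List.length_cons] at h1 h2
      omega
    · refine ⟨h, fun f' st' e => ?_⟩
      rw [hd] at e
      obtain ⟨rfl, rfl⟩ := List.cons.inj e
      exact hex

/-- The strategy stops with a stack of full height, on which `A` is small. -/
lemma exists_final_state (hp : Approximates p q A) (hT : 1 ≤ T) (x₀ : List Bool) :
    ∃ (s₀ : ℕ) (f : Frame) (st : List Frame), (run p q T x₀ s₀).2 = f :: st ∧
      st.length = maxDepth T ∧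
      ∀ f' st', (f' :: st') <:+ (f :: st) → scaled A T f'.1 ≤
        eff T st'.length / goal f' * (((run p q T x₀ s₀).1 : ℝ) - f'.2.1) := by
  obtain ⟨s₀, hs₀⟩ := exists_run_eq hp hT x₀
  have hstep : ∀ s, s₀ ≤ s → step p q T x₀ s (run p q T x₀ s₀) = run p q T x₀ s₀ := by
    intro s hs
    have h := hs₀ (s + 1) (by omega)
    rwa [run, hs₀ s hs] at h
  obtain ⟨f, st, hst, hlen⟩ := extend_eq_self (eq_extend_of_update_eq_self (hstep s₀ le_rfl)).1
  refine ⟨s₀, f, st, hst, hlen, fun f' st' hsuf => ?_⟩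
  obtain ⟨i, hi⟩ : ∃ i, (run p q T x₀ s₀).2.drop i = f' :: st' := by
    rw [← hst] at hsuf
    exact ⟨_, (List.suffix_iff_eq_drop.1 hsuf).symm⟩
  have P := (inv_run hp hT x₀ s₀).frameOk_of_drop hi
  -- Position `i` is checked at the times `Nat.pair i t`; since it never exceeds its threshold
  -- there, neither does the limit.
  have hlim := ((hp.tendsto f'.1).mul_const ((base T : ℝ) ^ (maxDepth T + 1))).comp
    (show Filter.Tendsto (fun t => Nat.pair i t) Filter.atTop Filter.atTop from
      Filter.tendsto_atTop_mono (Nat.right_le_pair i) Filter.tendsto_id)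
  refine le_of_tendsto hlim ?_
  filter_upwards [Filter.eventually_ge_atTop s₀] with t ht
  have h := (eq_extend_of_update_eq_self (hstep (Nat.pair i t)
    (ht.trans (Nat.right_le_pair i t)))).2 f' st' (by rwa [Nat.unpair_pair])
  rw [exceeds_iff (by have := P.add_size_le; omega) P.num_pos P.den_pos, not_le] at h
  simp only [Nat.unpair_pair, hi, List.headI_cons] at h
  exact h.le

lemma FrameOk.root_isPrefix {x₀ : List Bool} {G : ℕ} {f : Frame} {st : List Frame}
    (H : FrameOk A T x₀ G f st) : x₀ <+: f.1 := by
  induction st generalizing f with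
  | nil =>
    rw [show f.1 = child x₀ f.2.1 from congrArg Prod.fst H.eq_newFrame]
    exact List.prefix_append _ _
  | cons f' st ih =>
    rw [show f.1 = child f'.1 f.2.1 from congrArg Prod.fst H.eq_newFrame]
    exact (ih H.parent).trans (List.prefix_append _ _)

/-- On a stack where `A` is small, the part of the goal above the node `f` has been gained. -/
lemma FrameOk.sub_goal_le {x₀ : List Bool} {G : ℕ} {f : Frame} {st : List Frame}
    {F : List Bool → ℝ≥0∞} {ω : ℕ → Bool} (hA : ∀ x, 0 < A x)
    (H : FrameOk A T x₀ G f st)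
    (hsmall : ∀ f' st', (f' :: st') <:+ st →
      A f'.1 ≤ eff T st'.length / goal f' * ((G : ℝ) - f'.2.1))
    (hF : ∀ f' st', (f' :: st') <:+ st → ENNReal.ofReal (size T st'.length / A f'.1) ≤ F f'.1)
    (hω : ∀ x, x <+: f.1 → pre ω x.length = x) :
    ENNReal.ofReal (T - goal f) ≤ ∑ n ∈ Finset.range f.1.length, F (pre ω n) := by
  induction st generalizing f with
  | nil =>
    have e : goal f = T := by
      have := congrArg (fun y : Frame => y.2.2) H.eq_newFrame
      simp only [newFrame] at this
      simp [goal, this]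
    simp [e]
  | cons f' st ih =>
    obtain ⟨P', -⟩ := inv_cons.1 H.inv
    have P := H.parent
    have ex : f.1 = child f'.1 f.2.1 := congrArg Prod.fst H.eq_newFrame
    have hpre : f'.1 <+: f.1 := by rw [ex]; exact List.prefix_append _ _
    have hlen : f'.1.length + 1 ≤ f.1.length := by rw [ex, child]; simp
    have hrec := ih P (fun f₂ st₂ h => hsmall f₂ st₂ (h.trans (List.suffix_cons _ _)))
      (fun f₂ st₂ h => hF f₂ st₂ (h.trans (List.suffix_cons _ _)))
      (fun x hx => hω x (hx.trans hpre))
    have hl := H.length_le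
    rw [List.length_cons] at hl
    have hs : (0 : ℝ) < size T st.length := by exact_mod_cast size_pos T _
    have hw := P'.size_le
    have hw0 : (0 : ℝ) < (f.2.1 : ℝ) - f'.2.1 := hs.trans_le hw
    -- The child's subtree spends at most `d`, which is at most the `w` at its creation; this is the
    -- `2` in the definition of the goal.
    have hG : (G : ℝ) - f'.2.1 ≤ 2 * ((f.2.1 : ℝ) - f'.2.1) := by
      have h1 := H.le_add
      rw [List.length_cons, base_mul_size hl] at h1
      have : (G : ℝ) ≤ f.2.1 + size T st.length := by exact_mod_cast h1
      linarith
    have hK := P.goal_pos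
    have heff : 0 < eff T st.length := by linarith [one_le_eff P.length_le]
    have hgain : goal f' - goal f ≤ size T st.length / A f'.1 := by
      have e : goal f' - goal f =
          size T st.length / (eff T st.length / goal f' * (2 * ((f.2.1 : ℝ) - f'.2.1))) := by
        rw [H.goal_eq]
        field_simp
        ring
      rw [e]
      refine div_le_div_of_nonneg_left hs.le (hA _) ?_
      exact (hsmall f' st (List.suffix_refl _)).trans
        (mul_le_mul_of_nonneg_left hG (by positivity))
    calc ENNReal.ofReal (T - goal f)
        ≤ ENNReal.ofReal ((T - goal f') + size T st.length / A f'.1) :=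
          ENNReal.ofReal_le_ofReal (by linarith)
      _ ≤ ENNReal.ofReal (T - goal f') + ENNReal.ofReal (size T st.length / A f'.1) :=
          ENNReal.ofReal_add_le
      _ ≤ ∑ n ∈ Finset.range f'.1.length, F (pre ω n) + F f'.1 :=
          add_le_add hrec (hF f' st (List.suffix_refl _))
      _ = ∑ n ∈ Finset.range (f'.1.length + 1), F (pre ω n) := by
          rw [Finset.sum_range_succ, hω _ hpre]
      _ ≤ _ := Finset.sum_le_sum_of_subset (Finset.range_subset_range.2 hlen)

/-- The strategy gains `T` along some branch through `x₀`. -/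
lemma exists_le_prefixSum (hp : Approximates p q A) (hpos : ∀ x, 0 < A x) (hT : 1 ≤ T)
    (x₀ : List Bool) {F : List Bool → ℝ≥0∞}
    (hF : ∀ r x l, request p q T x₀ r = some (x, l) → ENNReal.ofReal ((1 / 2) ^ l / A x) ≤ F x) :
    ∃ ω, pre ω x₀.length = x₀ ∧ (T : ℝ≥0∞) ≤ prefixSum F ω := by
  obtain ⟨s₀, f, st, hst, hlen, hsmall⟩ := exists_final_state hp hT x₀
  have hb : (0 : ℝ) < base T := by exact_mod_cast base_pos T
  have hinv := inv_run hp hT x₀ s₀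
  rw [hst] at hinv
  obtain ⟨P, -⟩ := inv_cons.1 hinv
  have hsc : ∀ x, 0 < scaled A T x := fun x => mul_pos (hpos x) (by positivity)
  have hF' : ∀ f' st', (f' :: st') <:+ (f :: st) →
      ENNReal.ofReal (size T st'.length / scaled A T f'.1) ≤ F f'.1 := by
    intro f' st' hsuf
    obtain ⟨r, hr⟩ := exists_request_of_suffix p q T x₀ (hst ▸ hsuf)
    refine le_trans (ENNReal.ofReal_le_ofReal (le_of_eq ?_)) (hF r _ _ hr)
    have hle : st'.length ≤ maxDepth T := by
      have := hsuf.length_le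
      simp only [List.length_cons] at this
      omega
    have := (hpos f'.1).ne'
    rw [half_pow_baseExp_mul hle, scaled]
    field_simp
  have hω : ∀ x, x <+: f.1 → pre (fun i => f.1.getD i false) x.length = x :=
    fun x hx => pre_length_of_prefix hx
  refine ⟨fun i => f.1.getD i false, hω _ P.root_isPrefix, ?_⟩
  have hsub := P.sub_goal_le hsc
    (fun f' st' h => hsmall f' st' (h.trans (List.suffix_cons _ _)))
    (fun f' st' h => hF' f' st' (h.trans (List.suffix_cons _ _))) hω
  have hK := P.goal_pos
  have hs : (0 : ℝ) < size T st.length := by exact_mod_cast size_pos T _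
  have hlast : goal f ≤ size T st.length / scaled A T f.1 := by
    have h1 := hsmall f st (List.suffix_refl _)
    have h2 : (((run p q T x₀ s₀).1 : ℝ) - f.2.1) = size T st.length := by
      have := P.eq_of_leaf hlen
      rw [this]
      push_cast
      ring
    rw [h2, hlen, eff_maxDepth] at h1
    rw [le_div_iff₀ (hsc _)]
    calc goal f * scaled A T f.1
        ≤ goal f * (1 / goal f * size T (maxDepth T)) := by gcongr
      _ = size T st.length := by rw [hlen]; field_simp
  calc (T : ℝ≥0∞) = ENNReal.ofReal ((T - goal f) + goal f) := by simp
    _ ≤ ENNReal.ofReal (T - goal f) + ENNReal.ofReal (goal f) := ENNReal.ofReal_add_le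
    _ ≤ ∑ n ∈ Finset.range f.1.length, F (pre (fun i => f.1.getD i false) n) + F f.1 :=
        add_le_add hsub ((ENNReal.ofReal_le_ofReal hlast).trans (hF' f st (List.suffix_refl _)))
    _ = ∑ n ∈ Finset.range (f.1.length + 1), F (pre (fun i => f.1.getD i false) n) := by
        rw [Finset.sum_range_succ, hω _ (List.prefix_refl _)]
    _ ≤ _ := ENNReal.sum_le_tsum _

end

/-! #### Computability of the strategy -/

lemma primrec_baseExp : Primrec baseExp :=
  Primrec.succ.comp (Primrec.nat_mul.comp (Primrec.const 6) Primrec.id)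

lemma primrec_base : Primrec base := primrec_pow.comp (Primrec.const 2) primrec_baseExp

lemma primrec_cap : Primrec cap :=
  primrec_pow.comp (Primrec.const 2) (Primrec.nat_mul.comp (Primrec.const 6) Primrec.id)

lemma primrec_maxDepth : Primrec maxDepth :=
  Primrec.nat_mul.comp primrec_base (Primrec.nat_sub.comp Primrec.id (Primrec.const 1))

lemma primrec_size : Primrec₂ size :=
  primrec_pow.comp (primrec_base.comp Primrec.fst)
    (Primrec.nat_sub.comp (primrec_maxDepth.comp Primrec.fst) Primrec.snd)

lemma primrec_rate : Primrec₂ rate :=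
  Primrec.nat_sub.comp (Primrec.nat_add.comp (primrec_base.comp Primrec.fst)
    (primrec_maxDepth.comp Primrec.fst)) Primrec.snd

lemma primrec_child : Primrec₂ child := by
  have hrep : Primrec (fun i => List.replicate i true) := by
    refine (Primrec.list_map Primrec.list_range (Primrec₂.const true)).of_eq fun i => ?_
    simp [List.map_const']
  exact Primrec.list_append.comp Primrec.fst
    (Primrec.list_append.comp (hrep.comp Primrec.snd) (Primrec.const [false]))

section
variable {α : Type*} [Primcodable α] {T G i P Q : α → ℕ} {x₀ : α → List Bool} {S : α → State}
  {st : α → List Frame}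

lemma primrec_newFrame (hT : Primrec T) (hx : Primrec x₀) (hG : Primrec G) (hst : Primrec st) :
    Primrec fun a => newFrame (T a) (x₀ a) (G a) (st a) := by
  have h : Primrec fun a => (List.casesOn (st a) (child (x₀ a) (G a), G a, T a, 1)
      (fun f st => (child f.1 (G a), G a,
        f.2.2.1 * (2 * (G a - f.2.1) * rate (T a) st.length - size (T a) st.length * base (T a)),
        f.2.2.2 * (2 * (G a - f.2.1) * rate (T a) st.length))) : Frame) := by
    refine Primrec.list_casesOn (h := fun a (b : Frame × List Frame) =>
      ((child b.1.1 (G a), G a,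
        b.1.2.2.1 * (2 * (G a - b.1.2.1) * rate (T a) b.2.length
          - size (T a) b.2.length * base (T a)),
        b.1.2.2.2 * (2 * (G a - b.1.2.1) * rate (T a) b.2.length)) : Frame)) hst ((primrec_child.comp hx hG).pair
      (hG.pair (hT.pair (Primrec.const 1)))) ?_
    have hf : Primrec (fun b : α × Frame × List Frame => b.2.1) := Primrec.fst.comp Primrec.snd
    have hl : Primrec (fun b : α × Frame × List Frame => b.2.2.length) :=
      Primrec.list_length.comp (Primrec.snd.comp Primrec.snd)
    have hT' : Primrec (fun b : α × Frame × List Frame => T b.1) := hT.comp Primrec.fst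
    have hG' : Primrec (fun b : α × Frame × List Frame => G b.1) := hG.comp Primrec.fst
    have hf2 := Primrec.snd.comp hf
    have hf3 := Primrec.snd.comp hf2
    have hw : Primrec (fun b : α × Frame × List Frame =>
        2 * (G b.1 - b.2.1.2.1) * rate (T b.1) b.2.2.length) :=
      Primrec.nat_mul.comp (Primrec.nat_mul.comp (Primrec.const 2)
        (Primrec.nat_sub.comp hG' (Primrec.fst.comp hf2))) (primrec_rate.comp hT' hl)
    exact (primrec_child.comp (Primrec.fst.comp hf) hG').pair (hG'.pair
      ((Primrec.nat_mul.comp (Primrec.fst.comp hf3) (Primrec.nat_sub.comp hw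
        (Primrec.nat_mul.comp (primrec_size.comp hT' hl) (primrec_base.comp hT')))).pair
        (Primrec.nat_mul.comp (Primrec.snd.comp hf3) hw)))
  refine h.of_eq fun a => ?_
  cases st a <;> rfl

lemma primrec_extend (hT : Primrec T) (hx : Primrec x₀) (hS : Primrec S) :
    Primrec fun a => extend (T a) (x₀ a) (S a) := by
  have hG : Primrec fun a => (S a).1 := Primrec.fst.comp hS
  have h : Primrec fun a => (List.casesOn (S a).2
      ((S a).1 + size (T a) 0, [newFrame (T a) (x₀ a) (S a).1 []])
      (fun f st => if st.length = maxDepth (T a) then S a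
        else if cap (T a) * size (T a) st.length ≤ (S a).1 - f.2.1 then ((S a).1, st)
        else ((S a).1 + size (T a) (st.length + 1),
          newFrame (T a) (x₀ a) (S a).1 (f :: st) :: f :: st)) : State) := by
    refine Primrec.list_casesOn (h := fun a (b : Frame × List Frame) =>
      ((if b.2.length = maxDepth (T a) then S a
        else if cap (T a) * size (T a) b.2.length ≤ (S a).1 - b.1.2.1 then ((S a).1, b.2)
        else ((S a).1 + size (T a) (b.2.length + 1),
          newFrame (T a) (x₀ a) (S a).1 (b.1 :: b.2) :: b.1 :: b.2)) : State))
      (Primrec.snd.comp hS) ?_ ?_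
    · exact (Primrec.nat_add.comp hG (primrec_size.comp hT (Primrec.const 0))).pair
        (Primrec.list_cons.comp (primrec_newFrame hT hx hG (Primrec.const [])) (Primrec.const []))
    · have hl : Primrec (fun b : α × Frame × List Frame => b.2.2.length) :=
        Primrec.list_length.comp (Primrec.snd.comp Primrec.snd)
      have hT' : Primrec (fun b : α × Frame × List Frame => T b.1) := hT.comp Primrec.fst
      have hG' : Primrec (fun b : α × Frame × List Frame => (S b.1).1) := hG.comp Primrec.fst
      have hst : Primrec (fun b : α × Frame × List Frame => b.2.1 :: b.2.2) :=
        Primrec.list_cons.comp (Primrec.fst.comp Primrec.snd) (Primrec.snd.comp Primrec.snd)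
      refine Primrec.ite (Primrec.eq.comp hl (primrec_maxDepth.comp hT')) (hS.comp Primrec.fst)
        (Primrec.ite (Primrec.nat_le.comp
          (Primrec.nat_mul.comp (primrec_cap.comp hT') (primrec_size.comp hT' hl))
          (Primrec.nat_sub.comp hG' ?_)) (hG'.pair (Primrec.snd.comp Primrec.snd)) ?_)
      · exact Primrec.fst.comp (Primrec.snd.comp (Primrec.fst.comp Primrec.snd))
      · exact (Primrec.nat_add.comp hG' (primrec_size.comp hT' (Primrec.succ.comp hl))).pair
          (Primrec.list_cons.comp (primrec_newFrame hT' (hx.comp Primrec.fst) hG' hst) hst)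
  refine h.of_eq fun a => ?_
  unfold extend
  cases (S a).2 <;> rfl

lemma primrec_update (hT : Primrec T) (hx : Primrec x₀) (hi : Primrec i) (hP : Primrec P)
    (hQ : Primrec Q) (hS : Primrec S) :
    Primrec fun a => update (T a) (x₀ a) (i a) (P a) (Q a) (S a) := by
  have hext := primrec_extend hT hx hS
  have h : Primrec fun a => (List.casesOn ((S a).2.drop (i a)) (extend (T a) (x₀ a) (S a))
      (fun f st => if (Q a + 1) * (rate (T a) st.length * ((S a).1 - f.2.1) * f.2.2.2) ≤
          P a * f.2.2.1 * base (T a) ^ (maxDepth (T a) + 2)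
        then ((S a).1, st) else extend (T a) (x₀ a) (S a)) : State) := by
    refine Primrec.list_casesOn (h := fun a (b : Frame × List Frame) =>
      ((if (Q a + 1) * (rate (T a) b.2.length * ((S a).1 - b.1.2.1) * b.1.2.2.2) ≤
          P a * b.1.2.2.1 * base (T a) ^ (maxDepth (T a) + 2)
        then ((S a).1, b.2) else extend (T a) (x₀ a) (S a)) : State)) (Primrec.list_drop.comp hi (Primrec.snd.comp hS)) hext ?_
    have hl : Primrec (fun b : α × Frame × List Frame => b.2.2.length) :=
      Primrec.list_length.comp (Primrec.snd.comp Primrec.snd)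
    have hT' : Primrec (fun b : α × Frame × List Frame => T b.1) := hT.comp Primrec.fst
    have hG' : Primrec (fun b : α × Frame × List Frame => (S b.1).1) :=
      Primrec.fst.comp (hS.comp Primrec.fst)
    have hf2 : Primrec (fun b : α × Frame × List Frame => b.2.1.2) :=
      Primrec.snd.comp (Primrec.fst.comp Primrec.snd)
    have hf3 := Primrec.snd.comp hf2
    refine Primrec.ite (Primrec.nat_le.comp ?_ ?_) (hG'.pair (Primrec.snd.comp Primrec.snd))
      (hext.comp Primrec.fst)
    · exact Primrec.nat_mul.comp (Primrec.succ.comp (hQ.comp Primrec.fst))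
        (Primrec.nat_mul.comp (Primrec.nat_mul.comp (primrec_rate.comp hT' hl)
          (Primrec.nat_sub.comp hG' (Primrec.fst.comp hf2))) (Primrec.snd.comp hf3))
    · exact Primrec.nat_mul.comp (Primrec.nat_mul.comp (hP.comp Primrec.fst)
        (Primrec.fst.comp hf3)) (primrec_pow.comp (primrec_base.comp hT')
          (Primrec.nat_add.comp (primrec_maxDepth.comp hT') (Primrec.const 2)))
  refine h.of_eq fun a => ?_
  unfold update
  cases (S a).2.drop (i a) <;> rfl

end

lemma primrec_requestOf : Primrec fun a : ℕ × State × State => requestOf a.1 a.2.1 a.2.2 := by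
  have h1 : Primrec fun a : ℕ × State × State => a.2.1.2 :=
    Primrec.snd.comp (Primrec.fst.comp Primrec.snd)
  have h2 : Primrec fun a : ℕ × State × State => a.2.2.2 :=
    Primrec.snd.comp (Primrec.snd.comp Primrec.snd)
  exact Primrec.ite (Primrec.nat_lt.comp (Primrec.list_length.comp h1)
    (Primrec.list_length.comp h2))
    (Primrec.option_some.comp ((Primrec.fst.comp (Primrec.list_headI.comp h2)).pair
      (Primrec.nat_mul.comp (primrec_baseExp.comp Primrec.fst) (Primrec.list_length.comp h2))))
    (Primrec.const none)

section
variable {p q : List Bool → ℕ → ℕ} {T : ℕ → ℕ} {x₀ : ℕ → List Bool}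

lemma computable_step (hp : Computable₂ p) (hq : Computable₂ q) (hT : Primrec T)
    (hx : Primrec x₀) :
    Computable fun a : ℕ × ℕ × State => step p q (T a.1) (x₀ a.1) a.2.1 a.2.2 := by
  have hcore : Primrec fun b : (ℕ × ℕ × State) × ℕ × ℕ =>
      update (T b.1.1) (x₀ b.1.1) b.1.2.1.unpair.1 b.2.1 b.2.2 b.1.2.2 :=
    primrec_update (hT.comp (Primrec.fst.comp Primrec.fst))
      (hx.comp (Primrec.fst.comp Primrec.fst))
      (Primrec.fst.comp (Primrec.unpair.comp
        (Primrec.fst.comp (Primrec.snd.comp Primrec.fst))))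
      (Primrec.fst.comp Primrec.snd) (Primrec.snd.comp Primrec.snd)
      (Primrec.snd.comp (Primrec.snd.comp Primrec.fst))
  have hs : Primrec fun a : ℕ × ℕ × State => a.2.1 := Primrec.fst.comp Primrec.snd
  have hstr : Primrec fun a : ℕ × ℕ × State => (a.2.2.2.drop a.2.1.unpair.1).headI.1 :=
    Primrec.fst.comp (Primrec.list_headI.comp (Primrec.list_drop.comp
      (Primrec.fst.comp (Primrec.unpair.comp hs))
      (Primrec.snd.comp (Primrec.snd.comp Primrec.snd))))
  have harg : Computable fun a : ℕ × ℕ × State => (a,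
      (p (a.2.2.2.drop a.2.1.unpair.1).headI.1 a.2.1,
        q (a.2.2.2.drop a.2.1.unpair.1).headI.1 a.2.1)) :=
    Computable.id.pair ((hp.comp hstr.to_comp hs.to_comp).pair (hq.comp hstr.to_comp hs.to_comp))
  exact (hcore.to_comp.comp harg).of_eq fun a => rfl

lemma computable_run (hp : Computable₂ p) (hq : Computable₂ q) (hT : Primrec T)
    (hx : Primrec x₀) : Computable₂ fun e s => run p q (T e) (x₀ e) s := by
  have h : Computable fun a : ℕ × ℕ => (Nat.rec (0, [])
      (fun s S => step p q (T a.1) (x₀ a.1) s S) a.2 : State) := by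
    refine Computable.nat_rec (h := fun (a : ℕ × ℕ) (b : ℕ × State) =>
      step p q (T a.1) (x₀ a.1) b.1 b.2) Computable.snd (Computable.const _) ?_
    have harg : Computable fun b : (ℕ × ℕ) × ℕ × State => (b.1.1, b.2) :=
      (Computable.fst.comp Computable.fst).pair Computable.snd
    exact ((computable_step hp hq hT hx).comp harg).of_eq fun b => rfl
  refine h.of_eq fun a => ?_
  rcases a with ⟨e, s⟩
  induction s with
  | zero => rfl
  | succ s ih => exact congrArg (fun S => step p q (T e) (x₀ e) s S) ih

lemma computable_request (hp : Computable₂ p) (hq : Computable₂ q) (hT : Primrec T)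
    (hx : Primrec x₀) : Computable₂ fun e s => request p q (T e) (x₀ e) s := by
  have hrun := computable_run hp hq hT hx
  have harg : Computable fun a : ℕ × ℕ => (T a.1, run p q (T a.1) (x₀ a.1) a.2,
      run p q (T a.1) (x₀ a.1) (a.2 + 1)) :=
    (hT.to_comp.comp Computable.fst).pair
      ((hrun.comp Computable.fst Computable.snd).pair
        (hrun.comp Computable.fst (Computable.succ.comp Computable.snd)))
  exact (primrec_requestOf.to_comp.comp harg).of_eq fun a => rfl

end

/-! ### All strategies together -/

/-- The string below which the `e`-th strategy works. -/
def stringOf (e : ℕ) : List Bool := (Encodable.decode e.unpair.1).getD []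

/-- The requests of all strategies: for every `e`, the strategy with the goal `4 ^ e` below the
string `stringOf e`, with weights multiplied by `2 ^ -(e + 2)`. -/
def allRequests (p q : List Bool → ℕ → ℕ) : Requests := fun r =>
  (request p q (4 ^ r.unpair.1) (stringOf r.unpair.1)
    r.unpair.2).map fun y => (y.1, y.2 + (r.unpair.1 + 2))

lemma computable_allRequests {p q : List Bool → ℕ → ℕ} (hp : Computable₂ p)
    (hq : Computable₂ q) : Computable (allRequests p q) := by
  have hT : Primrec fun e : ℕ => 4 ^ e := primrec_pow.comp (Primrec.const 4) Primrec.id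
  have hx : Primrec stringOf :=
    Primrec.option_getD.comp (Primrec.decode.comp (Primrec.fst.comp Primrec.unpair))
      (Primrec.const [])
  have h1 : Computable fun r : ℕ => r.unpair.1 := Computable.fst.comp Computable.unpair
  have h2 : Computable fun r : ℕ => r.unpair.2 := Computable.snd.comp Computable.unpair
  refine Computable.option_map ((computable_request hp hq hT hx).comp h1 h2) ?_
  have h3 : Primrec fun b : ℕ × (List Bool × ℕ) => (b.2.1, b.2.2 + (b.1.unpair.1 + 2)) :=
    (Primrec.fst.comp Primrec.snd).pair (Primrec.nat_add.comp (Primrec.snd.comp Primrec.snd)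
      (Primrec.nat_add.comp (Primrec.fst.comp (Primrec.unpair.comp Primrec.fst))
        (Primrec.const 2)))
  exact h3.to_comp

/-! ### Joint weight and unbounded gain on every cylinder -/

section
variable {p q : List Bool → ℕ → ℕ} {A : List Bool → ℝ}

lemma weight_allRequests (r : ℕ) : weight (lengthOf (allRequests p q r)) =
    (1 / 2) ^ (r.unpair.1 + 2) * weight (lengthOf (request p q (4 ^ r.unpair.1)
      (stringOf r.unpair.1) r.unpair.2)) := by
  unfold allRequests
  cases request p q (4 ^ r.unpair.1) (stringOf r.unpair.1)
      r.unpair.2 with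
  | none => simp [lengthOf, weight]
  | some y =>
    simp only [lengthOf, Option.map_some, weight]
    rw [pow_add, mul_comm]

lemma kraftLe_allRequests (hp : Approximates p q A) : (allRequests p q).KraftLe := by
  intro n
  set W : ℕ × ℕ → ℝ := fun a => (1 / 2) ^ (a.1 + 2) * weight (lengthOf (request p q (4 ^ a.1)
    (stringOf a.1) a.2)) with hW
  have hW0 : ∀ a, 0 ≤ W a := fun a => mul_nonneg (by positivity) (weight_nonneg _)
  calc ∑ r ∈ Finset.range n, weight (lengthOf (allRequests p q r))
      = ∑ r ∈ Finset.range n, W r.unpair :=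
        Finset.sum_congr rfl fun r _ => weight_allRequests r
    _ = ∑ a ∈ (Finset.range n).image Nat.unpair, W a := by
        rw [Finset.sum_image]
        intro a _ b _ h
        have := congrArg (fun c : ℕ × ℕ => Nat.pair c.1 c.2) h
        simpa [Nat.pair_unpair] using this
    _ ≤ ∑ a ∈ Finset.range n ×ˢ Finset.range n, W a := by
        refine Finset.sum_le_sum_of_subset_of_nonneg ?_ fun a _ _ => hW0 a
        intro a ha
        obtain ⟨r, hr, rfl⟩ := Finset.mem_image.1 ha
        rw [Finset.mem_range] at hr
        simp only [Finset.mem_product, Finset.mem_range]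
        exact ⟨(Nat.unpair_left_le r).trans_lt hr, (Nat.unpair_right_le r).trans_lt hr⟩
    _ = ∑ e ∈ Finset.range n, ∑ s ∈ Finset.range n, W (e, s) := Finset.sum_product _ _ _
    _ ≤ ∑ e ∈ Finset.range n, (1 / 2) ^ (e + 1) := by
        refine Finset.sum_le_sum fun e _ => ?_
        simp only [hW]
        rw [← Finset.mul_sum, show (1 / 2 : ℝ) ^ (e + 1) = (1 / 2) ^ (e + 2) * 2 by
          rw [pow_succ _ (e + 1)]; ring]
        exact mul_le_mul_of_nonneg_left
          (sum_weight_request_le hp (Nat.one_le_pow _ _ (by norm_num)) _ n) (by positivity)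
    _ ≤ 1 := by
        have h : ∀ n : ℕ, ∑ e ∈ Finset.range n, (1 / 2 : ℝ) ^ (e + 1) = 1 - (1 / 2) ^ n := by
          intro n
          induction n with
          | zero => simp
          | succ n ih => rw [Finset.sum_range_succ, ih, pow_succ]; ring
        rw [h]
        have : (0 : ℝ) ≤ (1 / 2) ^ n := by positivity
        linarith

lemma exists_lt_prefixSum (hp : Approximates p q A) (hpos : ∀ x, 0 < A x) (x : List Bool)
    (N : ℕ) : ∃ ω, pre ω x.length = x ∧
      (N : ℝ≥0∞) < prefixSum (fun x => requestSup (allRequests p q) x / ENNReal.ofReal (A x)) ω := by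
  -- This `e` works below `x` and is at least `N + 4`, so the scaled gain `4 ^ e / 2 ^ (e + 2)`
  -- exceeds `N`.
  set e := Nat.pair (Encodable.encode x) (N + 4) with he
  set F : List Bool → ℝ≥0∞ := fun x =>
    2 ^ (e + 2) * (requestSup (allRequests p q) x / ENNReal.ofReal (A x)) with hFdef
  have hx : stringOf e = x := by
    rw [he, stringOf, Nat.unpair_pair, Encodable.encodek, Option.getD_some]
  have hF : ∀ r y l, request p q (4 ^ e) x r = some (y, l) →
      ENNReal.ofReal ((1 / 2) ^ l / A y) ≤ F y := by
    intro r y l hr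
    have hr' : allRequests p q (Nat.pair e r) = some (y, l + (e + 2)) := by
      unfold allRequests
      rw [Nat.unpair_pair]
      simp only [hx, hr, Option.map_some]
    have h2 : (2 : ℝ≥0∞) ^ (e + 2) = ENNReal.ofReal (2 ^ (e + 2)) := by
      rw [ENNReal.ofReal_pow two_pos.le, ENNReal.ofReal_ofNat]
    have h3 : (1 / 2 : ℝ) ^ l = 2 ^ (e + 2) * (1 / 2) ^ (l + (e + 2)) := by
      rw [pow_add _ l, mul_left_comm, ← mul_pow]
      norm_num
    rw [ENNReal.ofReal_div_of_pos (hpos y), h3, ENNReal.ofReal_mul (by positivity), ← h2,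
      mul_div_assoc]
    simp only [hFdef]
    gcongr
    exact le_requestSup hr'
  obtain ⟨ω, hω, hle⟩ := exists_le_prefixSum hp hpos (T := 4 ^ e) (Nat.one_le_pow _ _ (by norm_num)) x hF
  refine ⟨ω, hω, ?_⟩
  have hmul : prefixSum F ω = 2 ^ (e + 2) *
      prefixSum (fun x => requestSup (allRequests p q) x / ENNReal.ofReal (A x)) ω :=
    ENNReal.tsum_mul_left
  rw [hmul] at hle
  by_contra! hcon
  have h1 : ((4 ^ e : ℕ) : ℝ≥0∞) ≤ ((2 ^ (e + 2) * N : ℕ) : ℝ≥0∞) := by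
    refine hle.trans ?_
    push_cast
    gcongr
  have h2 : 4 ^ e ≤ 2 ^ (e + 2) * N := by exact_mod_cast h1
  have h3 : (4 : ℕ) ^ e = 2 ^ e * 2 ^ e := by rw [← mul_pow]; norm_num
  have h4 : 2 ^ e ≤ 4 * N := by
    rw [h3, pow_add, mul_assoc] at h2
    simpa using Nat.le_of_mul_le_mul_left h2 (by positivity)
  have h5 : N + 4 ≤ e := Nat.right_le_pair _ _
  have h6 : 2 ^ (N + 4) ≤ 2 ^ e := Nat.pow_le_pow_right two_pos h5
  have h7 : N < 2 ^ N := Nat.lt_two_pow_self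
  rw [pow_add] at h6
  omega

end

end Apriori

theorem theorem1 (m A : List Bool → ℝ)
    (hm : Apriori.IsDiscreteApriori m) (hA : Apriori.IsContinuousApriori A) :
    ∃ ω : ℕ → Bool,
      (∑' n : ℕ, ENNReal.ofReal (m (Apriori.pre ω n) / A (Apriori.pre ω n)) = ⊤) ∧
      ∀ D : List Bool →. List Bool, Apriori.IsOptimalPrefixFreeMachine D →
        ∑' n : ℕ, ENNReal.ofReal ((2 : ℝ) ^
          (Apriori.KA A (Apriori.pre ω n) - ((Apriori.KP D (Apriori.pre ω n)).toNat : ℝ))) = ⊤ := by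
  obtain ⟨p, q, hp, hq, h⟩ := hA.lsc
  have happ : Apriori.Approximates p q A := ⟨hA.semimeasure, fun x => (h x).1, fun x => (h x).2⟩
  have hc := Apriori.computable_allRequests hp hq
  have hk := Apriori.kraftLe_allRequests happ
  obtain ⟨ω, hω⟩ := Apriori.exists_prefixSum_eq_top (Apriori.exists_lt_prefixSum happ hA.pos)
  exact ⟨ω, Apriori.tsum_discreteApriori_eq_top hc hk hm hA.pos hω,
    fun D hD => Apriori.tsum_KA_sub_KP_eq_top hc hk hD hA.pos hω⟩
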